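/- Let $0<d<\pi/2$ and $\mathscr{D}_d=\{\zeta\in\mathbb{C}:|\operatorname{Im}\zeta|<d\}$, $\mathscr{D}_d^-=\{\zeta\in\mathscr{D}_d:\operatorname{Re}\zeta<0\}$, $\mathscr{D}_d^+=\{\zeta\in\mathscr{D}_d:\operatorname{Re}\zeta\ge 0\}$. Let $\psi(\zeta)=\sinh\left(\frac{\pi}{2}\sinh\zeta\right)$, and let $\psi^{-1}:\mathbb{R}\to\mathbb{R}$ denote the inverse of its restriction $\psi:\mathbb{R}\to\mathbb{R}$. For $\gamma>0$ put $E_1(z;\gamma)=(1+z^2)^{-(\gamma+1)/2}$ and $$x_\gamma=\begin{cases}\operatorname{arcsinh}\left(\dfrac{\sqrt{1+\sqrt{1-(2\pi\gamma)^2}}}{2\pi\gamma}\right)&\text{if }0<\gamma<1/(2\pi),\\[2mm] \operatorname{arcsinh}(1)&\text{if }\gamma\ge 1/(2\pi).\end{cases}$$ For $h>0$ and $k\in\mathbb{Z}$ let $$J(k,h)(x)=h\left\{\frac12+\frac1\pi\operatorname{Si}\left[\pi\left(\frac{x}{h}-k\right)\right]\right\},\qquad \operatorname{Si}(x)=\int_0^x\frac{\sin\sigma}{\sigma}\,d\sigma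 .$$ **Theorem.** Assume that $f$ is analytic in $\psi(\mathscr{D}_d)$ and that there are positive constants $K,\alpha,\beta$ such that $|f(z)|\le K|E_1(z;\alpha)|$ for all $z\in\psi(\mathscr{D}_d^-)$ and $|f(z)|\le K|E_1(z;\beta)|$ for all $z\in\psi(\mathscr{D}_d^+)$. Let $\mu=\min\{\alpha,\beta\}$, $\nu=\max\{\alpha,\beta\}$, let $n$ be a positive integer, let $$h=\frac{\log(4dn/\mu)}{n},$$ and let $$\begin{cases}M=n,\quad N=n-\lfloor\log(\beta/\alpha)/h\rfloor&\text{if }\mu=\alpha,\\ N=n,\quad M=n-\lfloor\log(\alpha/\beta)/h\rfloor&\text{if }\mu=\beta.\end{cases}$$ Suppose that $n$ is so large that $n\ge \nu e/(4d)$, $Mh\ge x_{\alpha/2}$ and $Nh\ge x_{\beta/2}$. Then $f$ is integrable on $\mathbb{R}$ and $$\sup_{\tau\in\mathbb{R}}\left|\int_{-\infty}^{\tau}f(t)\,dt-\sum_{k=-M}^{N}f(\psi(kh))\,\psi'(kh)\,J(k,h)(\psi^{-1}(\tau))\right|\le C_1\,\frac{\log(4dn/\mu)}{n}\,e^{-\pi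 dn/\log(4dn/\mu)},$$ where the constant $C_1$, independent of $n$, is $$C_1=\frac{2^{\nu+1}K}{\mu d}\left\{\frac{1}{\left(1-e^{-\pi\mu e/2}\right)\left\{\cos\left(\frac{\pi}{2}\sin d\right)\right\}^{\nu}\cos d}+e^{\pi(\alpha+\beta)/4}\right\}.$$ -/

import Mathlib

noncomputable section

namespace SincDE

/-- The open strip of half-width `d` around the real axis. -/
def strip (d : ℝ) : Set ℂ := {ζ : ℂ | |ζ.im| < d}

/-- The part of the strip with negative real part. -/
def stripNeg (d : ℝ) : Set ℂ := {ζ : ℂ | ζ ∈ strip d ∧ ζ.re < 0}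

/-- The part of the strip with nonnegative real part. -/
def stripPos (d : ℝ) : Set ℂ := {ζ : ℂ | ζ ∈ strip d ∧ 0 ≤ ζ.re}

/-- The double-exponential transformation `ψ(ζ) = sinh((π/2) sinh ζ)` on the complex plane. -/
def psi (ζ : ℂ) : ℂ := Complex.sinh ((Real.pi / 2 : ℂ) * Complex.sinh ζ)

/-- The inverse of the restriction `ψ : ℝ → ℝ`. -/
def psiInv (τ : ℝ) : ℝ := Real.arsinh (2 / Real.pi * Real.arsinh τ)

theorem psi_psiInv (τ : ℝ) : psi (psiInv τ : ℂ) = (τ : ℂ) := by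
  have h : Real.pi / 2 * (2 / Real.pi * Real.arsinh τ) = Real.arsinh τ := by
    field_simp
  have h2 : Real.sinh (Real.pi / 2 * Real.sinh (psiInv τ)) = τ := by
    rw [psiInv, Real.sinh_arsinh, h, Real.sinh_arsinh]
  rw [psi]
  exact_mod_cast congrArg (fun x : ℝ => (x : ℂ)) h2

theorem psiInv_unique (x τ : ℝ) (h : psi (x : ℂ) = (τ : ℂ)) : psiInv τ = x := by
  have h1 : Real.sinh (Real.pi / 2 * Real.sinh x) = τ := by
    rw [psi] at h
    exact_mod_cast h
  have h2 : 2 / Real.pi * (Real.pi / 2 * Real.sinh x) = Real.sinh x := by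
    field_simp
  rw [psiInv, ← h1, Real.arsinh_sinh, h2, Real.arsinh_sinh]

/-- `E₁(z; γ) = 1 / (1 + z²)^((γ+1)/2)`. Only its modulus is used, which does not depend on
the branch of the power. -/
def E1 (z : ℂ) (γ : ℝ) : ℂ := 1 / (1 + z ^ 2) ^ (((γ + 1) / 2 : ℝ) : ℂ)

/-- The sine integral `Si(x) = ∫₀ˣ sin σ / σ dσ`. -/
def Si (x : ℝ) : ℝ := ∫ σ in (0 : ℝ)..x, Real.sin σ / σ

/-- The basis function `J(k,h)` of the Sinc indefinite integration. -/
def J (k : ℤ) (h x : ℝ) : ℝ := h * (1 / 2 + 1 / Real.pi * Si (Real.pi * (x / h - k)))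

/-- The threshold `x_γ`. -/
def xThreshold (γ : ℝ) : ℝ :=
  if γ < 1 / (2 * Real.pi) then
    Real.arsinh (√(1 + √(1 - (2 * Real.pi * γ) ^ 2)) / (2 * Real.pi * γ))
  else Real.arsinh 1

/-- The lower truncation index `M`. -/
def indexM (α β h : ℝ) (n : ℕ) : ℤ :=
  if min α β = α then (n : ℤ) else (n : ℤ) - ⌊Real.log (α / β) / h⌋

/-- The upper truncation index `N`. -/
def indexN (α β h : ℝ) (n : ℕ) : ℤ :=
  if min α β = α then (n : ℤ) - ⌊Real.log (β / α) / h⌋ else (n : ℤ)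

/-- The rate `exp(-π d n / log(4 d n / μ)) log(4 d n / μ) / n`. -/
def rate (d μ : ℝ) (n : ℕ) : ℝ :=
  Real.exp (-(Real.pi * d * n / Real.log (4 * d * n / μ))) * Real.log (4 * d * n / μ) / n

/-- The explicit error constant. -/
def C1 (K d α β : ℝ) : ℝ :=
  2 ^ (max α β + 1) * K / (min α β * d) *
    (1 / ((1 - Real.exp (-(Real.pi * min α β * Real.exp 1 / 2))) *
        Real.cos (Real.pi / 2 * Real.sin d) ^ max α β * Real.cos d) +
      Real.exp (Real.pi * (α + β) / 4))

end SincDE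

end

/-! The substitution `t = ψ(x)` turns the integral into that of `F = (f ∘ ψ) ψ'`, which decays
double-exponentially in the strip. By the residue theorem, the error of sinc interpolation of `F`
at `x` is an integral of `F` over the boundary of the strip with kernel
`sin (π x / h) / (sin (π z / h) (z - x))`. Integrated over `x`, the oscillating factor contributes
at most `h / d`, and `|sin (π z / h)| ≥ sinh (π d / h)` on the boundary, so the indefinite integral
of the interpolant, which is the series of the terms `F(k h) J(k, h)`, has an error of order
`h exp (-π d / h)`. The terms dropped from the series are controlled by the integral of
`cosh x exp (-a sinh x)`, whose primitive is explicit. The choice of `h`, `M` and `N` balances the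
two errors: `4 d n = μ exp (n h)` is at most `α exp (M h)` and `β exp (N h)`. -/

namespace SincDE

open MeasureTheory Filter Topology Set
open scoped Real
open Complex (I)

theorem integrableOn_exp_neg_mul_Ioi {x : ℝ} (hx : 0 < x) :
    IntegrableOn (fun s : ℝ => Real.exp (-(x * s))) (Ioi 0) := by
  simpa only [neg_mul] using exp_neg_integrableOn_Ioi 0 hx

theorem integral_exp_neg_mul_Ioi_zero {x : ℝ} (hx : 0 < x) :
    ∫ s in Ioi (0 : ℝ), Real.exp (-(x * s)) = 1 / x := by
  simpa [neg_mul, neg_div_neg_eq] using integral_exp_mul_Ioi (neg_lt_zero.mpr hx) 0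

theorem integral_sin_mul_exp_neg (T s : ℝ) :
    ∫ x in 0..T, Real.sin x * Real.exp (-(x * s)) =
      (1 + s ^ 2)⁻¹ - Real.exp (-(T * s)) * (s * Real.sin T + Real.cos T) / (1 + s ^ 2) := by
  have hprimitive : ∀ x ∈ uIcc 0 T, HasDerivAt
      (fun x => -(Real.exp (-(x * s)) * (s * Real.sin x + Real.cos x) / (1 + s ^ 2)))
      (Real.sin x * Real.exp (-(x * s))) x := by
    intro x _
    have hexp : HasDerivAt (fun x => Real.exp (-(x * s))) (Real.exp (-(x * s)) * (-(1 * s))) x :=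
      (((hasDerivAt_id x).mul_const s).neg).exp
    have htrig : HasDerivAt (fun x => s * Real.sin x + Real.cos x)
        (s * Real.cos x + -Real.sin x) x :=
      ((Real.hasDerivAt_sin x).const_mul s).add (Real.hasDerivAt_cos x)
    refine ((hexp.mul htrig).div_const (1 + s ^ 2)).neg.congr_deriv ?_
    field_simp
    ring
  rw [intervalIntegral.integral_eq_sub_of_hasDerivAt hprimitive
    ((by fun_prop : Continuous _).intervalIntegrable _ _)]
  simp only [zero_mul, neg_zero, Real.exp_zero, Real.sin_zero, mul_zero, Real.cos_zero]
  ring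

theorem norm_exp_neg_mul_trig_div_le (T s : ℝ) :
    ‖Real.exp (-(T * s)) * (s * Real.sin T + Real.cos T) / (1 + s ^ 2)‖ ≤
      Real.exp (-(T * s)) := by
  have hs : 0 < 1 + s ^ 2 := by positivity
  have htrig : |s * Real.sin T + Real.cos T| ≤ 1 + s ^ 2 := by
    refine abs_le_of_sq_le_sq ?_ hs.le
    nlinarith [Real.sin_sq_add_cos_sq T, sq_nonneg (s * Real.cos T - Real.sin T), sq_nonneg s]
  rw [norm_div, norm_mul, Real.norm_eq_abs, Real.abs_exp, Real.norm_eq_abs, Real.norm_eq_abs,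
    abs_of_pos hs, div_le_iff₀ hs]
  exact mul_le_mul_of_nonneg_left htrig (Real.exp_pos _).le

theorem integrable_uncurry_sin_mul_exp_neg (T : ℝ) :
    Integrable (Function.uncurry fun x s : ℝ => Real.sin x * Real.exp (-(x * s)))
      ((volume.restrict (Ioc 0 T)).prod (volume.restrict (Ioi 0))) := by
  rw [integrable_prod_iff (Continuous.aestronglyMeasurable (by fun_prop))]
  constructor
  · filter_upwards [ae_restrict_mem measurableSet_Ioc] with x hx
    exact Integrable.const_mul (integrableOn_exp_neg_mul_Ioi hx.1) (Real.sin x)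
  · have hsinc : IntegrableOn (fun x => |Real.sinc x|) (Ioc 0 T) :=
      Real.continuous_sinc.abs.integrableOn_Ioc
    refine hsinc.congr ?_
    filter_upwards [ae_restrict_mem measurableSet_Ioc] with x hx
    simp only [Function.uncurry_apply_pair, norm_mul, Real.norm_eq_abs, Real.abs_exp]
    rw [integral_const_mul, integral_exp_neg_mul_Ioi_zero hx.1, Real.sinc_of_ne_zero hx.1.ne',
      abs_div, abs_of_pos hx.1, mul_one_div]

-- Fubini applied to `1 / x = ∫₀^∞ exp (-x s) ds`.
theorem Si_eq_integral_Ioi {T : ℝ} (hT : 0 ≤ T) :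
    Si T = ∫ s in Ioi (0 : ℝ), ((1 + s ^ 2)⁻¹ -
      Real.exp (-(T * s)) * (s * Real.sin T + Real.cos T) / (1 + s ^ 2)) := by
  calc Si T = ∫ x in Ioc 0 T, ∫ s in Ioi (0 : ℝ), Real.sin x * Real.exp (-(x * s)) := by
        rw [Si, intervalIntegral.integral_of_le hT]
        refine setIntegral_congr_fun measurableSet_Ioc fun x hx => ?_
        rw [integral_const_mul, integral_exp_neg_mul_Ioi_zero hx.1, mul_one_div]
    _ = ∫ s in Ioi (0 : ℝ), ∫ x in Ioc 0 T, Real.sin x * Real.exp (-(x * s)) :=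
        integral_integral_swap (integrable_uncurry_sin_mul_exp_neg T)
    _ = _ := by
        simp only [← intervalIntegral.integral_of_le hT, integral_sin_mul_exp_neg]

theorem abs_Si_sub_pi_div_two_le {T : ℝ} (hT : 0 < T) : |Si T - π / 2| ≤ 1 / T := by
  have hexp := integrableOn_exp_neg_mul_Ioi hT
  have hremainder : IntegrableOn (fun s : ℝ =>
      Real.exp (-(T * s)) * (s * Real.sin T + Real.cos T) / (1 + s ^ 2)) (Ioi 0) :=
    hexp.mono'
      (Continuous.div (by fun_prop) (by fun_prop) fun s => by positivity).aestronglyMeasurable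
      (ae_of_all _ (norm_exp_neg_mul_trig_div_le T))
  rw [Si_eq_integral_Ioi hT.le, integral_sub integrable_inv_one_add_sq.integrableOn hremainder,
    integral_Ioi_inv_one_add_sq, Real.arctan_zero, sub_zero, sub_sub_cancel_left, abs_neg,
    ← integral_exp_neg_mul_Ioi_zero hT, ← Real.norm_eq_abs]
  exact norm_integral_le_of_norm_le hexp (ae_of_all _ (norm_exp_neg_mul_trig_div_le T))

theorem Si_eq_integral_sinc (x : ℝ) : Si x = ∫ σ in 0..x, Real.sinc σ := by
  refine intervalIntegral.integral_congr_ae ?_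
  filter_upwards [ae_iff.mpr (by simp : volume {σ : ℝ | ¬σ ≠ 0} = 0)] with σ hσ _
  rw [Real.sinc_of_ne_zero hσ]

theorem Si_neg (x : ℝ) : Si (-x) = -Si x := by
  have hsinc := intervalIntegral.integral_comp_neg (f := Real.sinc) (a := 0) (b := x)
  simp only [Real.sinc_neg, neg_zero] at hsinc
  rw [Si_eq_integral_sinc, Si_eq_integral_sinc, hsinc, intervalIntegral.integral_symm]

theorem hasDerivAt_Si (x : ℝ) : HasDerivAt Si (Real.sinc x) x := by
  rw [funext Si_eq_integral_sinc]
  exact intervalIntegral.integral_hasDerivAt_right (Real.continuous_sinc.intervalIntegrable _ _)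
    (Real.continuous_sinc.stronglyMeasurableAtFilter _ _) Real.continuous_sinc.continuousAt

theorem abs_Si_le_pi (x : ℝ) : |Si x| ≤ π := by
  wlog hx : 0 ≤ x generalizing x
  · simpa only [Si_neg, abs_neg] using this (-x) (by linarith)
  rcases le_or_gt x 1 with hx1 | hx1
  · have hsmall := intervalIntegral.norm_integral_le_of_norm_le_const (a := 0) (b := x) (C := 1)
      (f := Real.sinc) fun y _ => Real.abs_sinc_le_one y
    rw [← Si_eq_integral_sinc, Real.norm_eq_abs, sub_zero, abs_of_nonneg hx] at hsmall
    linarith [Real.pi_gt_three]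
  · have hlarge := abs_le.mp (abs_Si_sub_pi_div_two_le (by linarith : 0 < x))
    have hinv : 1 / x ≤ 1 := by rw [div_le_one (by linarith)]; exact hx1.le
    exact abs_le.mpr ⟨by linarith [Real.pi_gt_three], by linarith [Real.pi_gt_three]⟩

theorem tendsto_Si_atTop : Tendsto Si atTop (𝓝 (π / 2)) := by
  rw [tendsto_iff_norm_sub_tendsto_zero]
  refine squeeze_zero' (Eventually.of_forall fun _ => norm_nonneg _) ?_
    tendsto_inv_atTop_zero
  filter_upwards [eventually_gt_atTop 0] with x hx
  exact (abs_Si_sub_pi_div_two_le hx).trans_eq (one_div x)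

theorem tendsto_Si_atBot : Tendsto Si atBot (𝓝 (-(π / 2))) :=
  (tendsto_Si_atTop.comp tendsto_neg_atBot_atTop).neg.congr fun x => by simp [Si_neg]

section BasisFunction

variable (k : ℤ) {h : ℝ} (hh : 0 < h)

include hh

theorem abs_J_le (x : ℝ) : |J k h x| ≤ 3 / 2 * h := by
  have hSi : |1 / π * Si (π * (x / h - k))| ≤ 1 := by
    rw [abs_mul, abs_of_pos (by positivity), one_div_mul_eq_div, div_le_one Real.pi_pos]
    exact abs_Si_le_pi _
  rw [J, abs_mul, abs_of_pos hh, mul_comm]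
  refine mul_le_mul_of_nonneg_right ?_ hh.le
  rw [abs_le] at hSi ⊢
  constructor <;> linarith

theorem tendsto_J_atBot : Tendsto (J k h) atBot (𝓝 0) := by
  have harg : Tendsto (fun x : ℝ => π * (x / h - k)) atBot atBot :=
    (tendsto_atBot_add_const_right _ _ (tendsto_id.atBot_div_const hh)).const_mul_atBot Real.pi_pos
  have hlim := (((tendsto_Si_atBot.comp harg).const_mul (1 / π)).const_add (1 / 2)).const_mul h
  have hzero : h * (1 / 2 + 1 / π * -(π / 2)) = 0 := by
    field_simp
    ring
  rwa [hzero] at hlim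

theorem hasDerivAt_J (x : ℝ) : HasDerivAt (J k h) (Real.sinc (π * (x / h - k))) x := by
  have harg : HasDerivAt (fun x : ℝ => π * (x / h - k)) (π * (1 / h)) x :=
    (((hasDerivAt_id x).div_const h).sub_const _).const_mul _
  refine (((((hasDerivAt_Si _).comp x harg).const_mul (1 / π)).const_add
    (1 / 2)).const_mul h).congr_deriv ?_
  field_simp

theorem integral_sinc_eq_J_sub (a b : ℝ) :
    ∫ x in a..b, Real.sinc (π * (x / h - k)) = J k h b - J k h a :=
  intervalIntegral.integral_eq_sub_of_hasDerivAt (fun x _ => hasDerivAt_J k hh x)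
    ((Real.continuous_sinc.comp (by fun_prop)).intervalIntegrable _ _)

end BasisFunction

/-- The counterclockwise integral of `f` along the boundary of the rectangle
`[a, b] × [-c, c]`. -/
noncomputable def rectIntegral (f : ℂ → ℂ) (a b c : ℝ) : ℂ :=
  (∫ x : ℝ in a..b, f (x + ((-c : ℝ) : ℂ) * I)) - (∫ x : ℝ in a..b, f (x + c * I)) +
    I * (∫ y : ℝ in (-c)..c, f (b + y * I)) - I * (∫ y : ℝ in (-c)..c, f (a + y * I))

/-- The boundary of the rectangle `[a, b] × [-c, c]`, the path of integration of
`rectIntegral`. -/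
def rectBoundary (a b c : ℝ) : Set ℂ :=
  {z | z ∈ Icc a b ×ℂ Icc (-c) c ∧ (z.re = a ∨ z.re = b ∨ |z.im| = c)}

/-- The two boundary lines of the strip `|Im z| ≤ c`. -/
def stripBoundary (c : ℝ) : Set ℂ := {z | |z.im| = c}

/-- Integrability of `f` along both boundary lines of the strip `|Im z| ≤ c`, as needed for
`stripIntegral f c` to be meaningful. -/
def StripIntegrable (f : ℂ → ℂ) (c : ℝ) : Prop :=
  ∀ s : ℝ, |s| = c → Integrable fun t : ℝ => f (t + s * I)

/-- The integral of `f` along the boundary of the strip `|Im z| ≤ c`, the lower line being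
traversed to the right and the upper line to the left. -/
noncomputable def stripIntegral (f : ℂ → ℂ) (c : ℝ) : ℂ :=
  (∫ t : ℝ, f (t + ((-c : ℝ) : ℂ) * I)) - ∫ t : ℝ, f (t + c * I)

section Rectangle

variable {a b c : ℝ} {f g : ℂ → ℂ}

theorem add_mul_I_mem_rectBoundary_of_abs_eq {x y : ℝ} (hx : x ∈ Icc a b) (hy : |y| = c) :
    (x + y * I : ℂ) ∈ rectBoundary a b c :=
  ⟨by simpa [Complex.mem_reProdIm, ← hy, neg_abs_le, le_abs_self] using hx, by simp [hy]⟩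

theorem left_add_mul_I_mem_rectBoundary (hab : a ≤ b) {y : ℝ} (hy : y ∈ Icc (-c) c) :
    (a + y * I : ℂ) ∈ rectBoundary a b c :=
  ⟨by simpa [Complex.mem_reProdIm, hab] using hy, by simp⟩

theorem right_add_mul_I_mem_rectBoundary (hab : a ≤ b) {y : ℝ} (hy : y ∈ Icc (-c) c) :
    (b + y * I : ℂ) ∈ rectBoundary a b c :=
  ⟨by simpa [Complex.mem_reProdIm, hab] using hy, by simp⟩

theorem rectIntegral_congr (hab : a ≤ b) (hc : 0 ≤ c) (h : EqOn f g (rectBoundary a b c)) :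
    rectIntegral f a b c = rectIntegral g a b c := by
  have horizontal (s : ℝ) (hs : |s| = c) :
      ∫ x : ℝ in a..b, f (x + s * I) = ∫ x : ℝ in a..b, g (x + s * I) :=
    intervalIntegral.integral_congr fun x hx =>
      h (add_mul_I_mem_rectBoundary_of_abs_eq (uIcc_of_le hab ▸ hx) hs)
  have hcc := uIcc_of_le (neg_le_self hc)
  have right : ∫ y : ℝ in (-c)..c, f (b + y * I) = ∫ y : ℝ in (-c)..c, g (b + y * I) :=
    intervalIntegral.integral_congr fun y hy =>
      h (right_add_mul_I_mem_rectBoundary hab (hcc ▸ hy))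
  have left : ∫ y : ℝ in (-c)..c, f (a + y * I) = ∫ y : ℝ in (-c)..c, g (a + y * I) :=
    intervalIntegral.integral_congr fun y hy =>
      h (left_add_mul_I_mem_rectBoundary hab (hcc ▸ hy))
  rw [rectIntegral, horizontal (-c) (by rw [abs_neg, abs_of_nonneg hc]),
    horizontal c (abs_of_nonneg hc), right, left, rectIntegral]

theorem intervalIntegrable_horizontal (hab : a ≤ b) (hf : ContinuousOn f (rectBoundary a b c))
    {s : ℝ} (hs : |s| = c) : IntervalIntegrable (fun x : ℝ => f (x + s * I)) volume a b := by
  refine ContinuousOn.intervalIntegrable ?_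
  rw [uIcc_of_le hab]
  exact hf.comp (by fun_prop) fun x hx => add_mul_I_mem_rectBoundary_of_abs_eq hx hs

theorem intervalIntegrable_left (hab : a ≤ b) (hc : 0 ≤ c)
    (hf : ContinuousOn f (rectBoundary a b c)) :
    IntervalIntegrable (fun y : ℝ => f (a + y * I)) volume (-c) c := by
  refine ContinuousOn.intervalIntegrable ?_
  rw [uIcc_of_le (neg_le_self hc)]
  exact hf.comp (by fun_prop) fun y hy => left_add_mul_I_mem_rectBoundary hab hy

theorem intervalIntegrable_right (hab : a ≤ b) (hc : 0 ≤ c)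
    (hf : ContinuousOn f (rectBoundary a b c)) :
    IntervalIntegrable (fun y : ℝ => f (b + y * I)) volume (-c) c := by
  refine ContinuousOn.intervalIntegrable ?_
  rw [uIcc_of_le (neg_le_self hc)]
  exact hf.comp (by fun_prop) fun y hy => right_add_mul_I_mem_rectBoundary hab hy

theorem rectIntegral_add (hab : a ≤ b) (hc : 0 ≤ c) (hf : ContinuousOn f (rectBoundary a b c))
    (hg : ContinuousOn g (rectBoundary a b c)) :
    rectIntegral (fun z => f z + g z) a b c = rectIntegral f a b c + rectIntegral g a b c := by
  have hcneg : |-c| = c := by rw [abs_neg, abs_of_nonneg hc]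
  have hcpos : |c| = c := abs_of_nonneg hc
  unfold rectIntegral
  rw [intervalIntegral.integral_add (intervalIntegrable_horizontal hab hf hcneg)
      (intervalIntegrable_horizontal hab hg hcneg),
    intervalIntegral.integral_add (intervalIntegrable_horizontal hab hf hcpos)
      (intervalIntegrable_horizontal hab hg hcpos),
    intervalIntegral.integral_add (intervalIntegrable_left hab hc hf)
      (intervalIntegrable_left hab hc hg),
    intervalIntegral.integral_add (intervalIntegrable_right hab hc hf)
      (intervalIntegrable_right hab hc hg)]
  ring

theorem rectIntegral_const_mul (w : ℂ) (f : ℂ → ℂ) (a b c : ℝ) :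
    rectIntegral (fun z => w * f z) a b c = w * rectIntegral f a b c := by
  simp only [rectIntegral, intervalIntegral.integral_const_mul]
  ring

theorem rectIntegral_add_adjacent {e : ℝ} (hab : a ≤ b) (hbe : b ≤ e) (hc : 0 ≤ c)
    (hf : ContinuousOn f (rectBoundary a b c)) (hf' : ContinuousOn f (rectBoundary b e c)) :
    rectIntegral f a b c + rectIntegral f b e c = rectIntegral f a e c := by
  have hcneg : |-c| = c := by rw [abs_neg, abs_of_nonneg hc]
  have hcpos : |c| = c := abs_of_nonneg hc
  unfold rectIntegral
  rw [← intervalIntegral.integral_add_adjacent_intervals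
      (intervalIntegrable_horizontal hab hf hcneg) (intervalIntegrable_horizontal hbe hf' hcneg),
    ← intervalIntegral.integral_add_adjacent_intervals
      (intervalIntegrable_horizontal hab hf hcpos) (intervalIntegrable_horizontal hbe hf' hcpos)]
  ring

theorem rectIntegral_eq_zero_of_differentiableOn (hab : a ≤ b) (hc : 0 ≤ c)
    (hf : DifferentiableOn ℂ f (Icc a b ×ℂ Icc (-c) c)) : rectIntegral f a b c = 0 := by
  have hrect := Complex.integral_boundary_rect_eq_zero_of_differentiableOn f ⟨a, -c⟩ ⟨b, c⟩
    (by simpa only [uIcc_of_le hab, uIcc_of_le (neg_le_self hc)] using hf)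
  simpa only [rectIntegral, smul_eq_mul] using hrect

-- The factor `σ` rotates the segment `x ↦ u * x + w` off the branch cut of the logarithm.
theorem mul_integral_inv_segment {s t : ℝ} {u w σ : ℂ} (hσ : σ ≠ 0)
    (h : ∀ x ∈ uIcc s t, σ * (u * x + w) ∈ Complex.slitPlane) :
    u * ∫ x in s..t, (u * (x : ℂ) + w)⁻¹ =
      Complex.log (σ * (u * t + w)) - Complex.log (σ * (u * s + w)) := by
  have hne : ∀ x ∈ uIcc s t, u * (x : ℂ) + w ≠ 0 := fun x hx h0 =>
    Complex.slitPlane_ne_zero (h x hx) (by rw [h0, mul_zero])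
  rw [← intervalIntegral.integral_const_mul]
  refine intervalIntegral.integral_eq_sub_of_hasDerivAt
    (f := fun x : ℝ => Complex.log (σ * (u * x + w))) (fun x hx => ?_) ?_
  · have hlinear : HasDerivAt (fun z : ℂ => σ * (u * z + w)) (σ * (u * 1)) (x : ℂ) :=
      (((hasDerivAt_id _).const_mul u).add_const w).const_mul σ
    refine (HasDerivAt.comp_ofReal (hlinear.clog (h x hx))).congr_deriv ?_
    have := hne x hx
    field_simp
  · refine ContinuousOn.intervalIntegrable fun x hx => ContinuousAt.continuousWithinAt ?_
    exact continuousAt_const.mul (ContinuousAt.inv₀ (by fun_prop) (hne x hx))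

theorem log_neg_of_im_pos {w : ℂ} (hw : 0 < w.im) :
    Complex.log (-w) = Complex.log w - π * I := by
  rw [Complex.log, Complex.log, norm_neg, Complex.arg_neg_eq_arg_sub_pi_of_im_pos hw]
  push_cast
  ring

theorem log_neg_of_im_neg {w : ℂ} (hw : w.im < 0) :
    Complex.log (-w) = Complex.log w + π * I := by
  rw [Complex.log, Complex.log, norm_neg, Complex.arg_neg_eq_arg_add_pi_of_im_neg hw]
  push_cast
  ring

theorem rectIntegral_inv_sub {p : ℂ} (hp : p ∈ Ioo a b ×ℂ Ioo (-c) c) :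
    rectIntegral (fun z => (z - p)⁻¹) a b c = 2 * π * I := by
  obtain ⟨⟨hap, hpb⟩, hcp, hpc⟩ := Complex.mem_reProdIm.mp hp
  have bottom := mul_integral_inv_segment (s := a) (t := b) (u := 1)
    (w := ((-c : ℝ) : ℂ) * I - p) one_ne_zero
    fun x _ => Or.inr (by simpa using (by linarith : -c - p.im ≠ 0))
  have top := mul_integral_inv_segment (s := a) (t := b) (u := 1) (w := c * I - p) one_ne_zero
    fun x _ => Or.inr (by simpa using (by linarith : c - p.im ≠ 0))
  have right := mul_integral_inv_segment (s := -c) (t := c) (u := I) (w := b - p) one_ne_zero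
    fun x _ => Or.inl (by simpa using hpb)
  have left := mul_integral_inv_segment (s := -c) (t := c) (u := I) (w := a - p) (σ := -1)
    (by simp) fun x _ => Or.inl (by simpa using hap)
  have horizontal (x : ℝ) (w : ℂ) : (x : ℂ) + (w - p) = x + w - p := by ring
  have vertical (x y : ℝ) : I * (y : ℂ) + (x - p) = x + y * I - p := by ring
  simp only [one_mul, horizontal, vertical] at bottom top right left
  rw [rectIntegral, bottom, top, right, left, neg_one_mul, neg_one_mul,
    log_neg_of_im_pos (by simpa using hpc), log_neg_of_im_neg (by simpa using hcp)]
  ring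

theorem ne_of_mem_rectBoundary {p z : ℂ} (hp : p ∈ Ioo a b ×ℂ Ioo (-c) c)
    (hz : z ∈ rectBoundary a b c) : z ≠ p := by
  obtain ⟨⟨hap, hpb⟩, hp_im⟩ := Complex.mem_reProdIm.mp hp
  rintro rfl
  rcases hz.2 with h | h | h
  · exact hap.ne' h
  · exact hpb.ne h
  · exact (abs_lt.mpr hp_im).ne h

theorem rectIntegral_div_sub {p : ℂ} (hp : p ∈ Ioo a b ×ℂ Ioo (-c) c)
    (hf : DifferentiableOn ℂ f (Icc a b ×ℂ Icc (-c) c)) :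
    rectIntegral (fun z => f z / (z - p)) a b c = 2 * π * I * f p := by
  obtain ⟨⟨hap, hpb⟩, hcp, hpc⟩ := Complex.mem_reProdIm.mp hp
  have hab : a ≤ b := by linarith
  have hc : 0 ≤ c := by linarith
  have hnhds : Icc a b ×ℂ Icc (-c) c ∈ 𝓝 p :=
    mem_of_superset ((isOpen_Ioo.reProdIm isOpen_Ioo).mem_nhds hp)
      (inter_subset_inter (preimage_mono Ioo_subset_Icc_self) (preimage_mono Ioo_subset_Icc_self))
  have hslope : DifferentiableOn ℂ (dslope f p) (Icc a b ×ℂ Icc (-c) c) :=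
    (Complex.differentiableOn_dslope hnhds).mpr hf
  have hinv : ContinuousOn (fun z : ℂ => f p * (z - p)⁻¹) (rectBoundary a b c) :=
    continuousOn_const.mul <| ContinuousOn.inv₀ (by fun_prop) fun z hz =>
      sub_ne_zero.mpr (ne_of_mem_rectBoundary hp hz)
  have hsplit : EqOn (fun z => f z / (z - p)) (fun z => dslope f p z + f p * (z - p)⁻¹)
      (rectBoundary a b c) := by
    intro z hz
    have hne := ne_of_mem_rectBoundary hp hz
    have := sub_ne_zero.mpr hne
    simp only [dslope_of_ne _ hne, slope_def_field]
    field_simp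
    ring
  rw [rectIntegral_congr hab hc hsplit,
    rectIntegral_add hab hc (hslope.continuousOn.mono fun z hz => hz.1) hinv,
    rectIntegral_eq_zero_of_differentiableOn hab hc hslope, rectIntegral_const_mul,
    rectIntegral_inv_sub hp]
  ring

end Rectangle

section StripBoundary

variable {c : ℝ} {f g : ℂ → ℂ}

theorem add_mul_I_mem_stripBoundary {s : ℝ} (hs : |s| = c) (t : ℝ) :
    (t + s * I : ℂ) ∈ stripBoundary c := by
  simpa [stripBoundary] using hs

theorem stripIntegral_congr (hc : 0 ≤ c) (h : EqOn f g (stripBoundary c)) :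
    stripIntegral f c = stripIntegral g c := by
  have line (s : ℝ) (hs : |s| = c) : ∫ t : ℝ, f (t + s * I) = ∫ t : ℝ, g (t + s * I) :=
    integral_congr_ae (ae_of_all _ fun t => h (add_mul_I_mem_stripBoundary hs t))
  rw [stripIntegral, line (-c) (by rw [abs_neg, abs_of_nonneg hc]), line c (abs_of_nonneg hc),
    stripIntegral]

theorem stripIntegral_sub (hc : 0 ≤ c) (hf : StripIntegrable f c) (hg : StripIntegrable g c) :
    stripIntegral (fun z => f z - g z) c = stripIntegral f c - stripIntegral g c := by
  have hcneg : |-c| = c := by rw [abs_neg, abs_of_nonneg hc]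
  have hcpos : |c| = c := abs_of_nonneg hc
  simp only [stripIntegral]
  rw [integral_sub (hf _ hcneg) (hg _ hcneg), integral_sub (hf _ hcpos) (hg _ hcpos)]
  ring

theorem tendsto_rectIntegral {ρ : ℝ → ℝ} {R : ℕ → ℝ} (hc : 0 ≤ c) (hR : Tendsto R atTop atTop)
    (hρ : Tendsto ρ (cocompact ℝ) (𝓝 0)) (hf : StripIntegrable f c)
    (hside : ∀ n, ∀ z : ℂ, |z.im| ≤ c → |z.re| = |R n| → ‖f z‖ ≤ ρ z.re) :
    Tendsto (fun n => rectIntegral f (-R n) (R n) c) atTop (𝓝 (stripIntegral f c)) := by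
  have hR_neg : Tendsto (fun n => -R n) atTop atBot := tendsto_neg_atTop_atBot.comp hR
  have vertical (r : ℕ → ℝ) (hr : Tendsto r atTop (cocompact ℝ)) (hrR : ∀ n, |r n| = |R n|) :
      Tendsto (fun n => ∫ y : ℝ in (-c)..c, f (r n + y * I)) atTop (𝓝 0) := by
    have hbound : Tendsto (fun n => ρ (r n) * |c - -c|) atTop (𝓝 0) := by
      simpa only [zero_mul, Function.comp_def] using (hρ.comp hr).mul_const |c - -c|
    refine squeeze_zero_norm (fun n => ?_) hbound
    refine intervalIntegral.norm_integral_le_of_norm_le_const fun y hy => ?_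
    rw [uIoc_of_le (neg_le_self hc)] at hy
    simpa using hside n (r n + y * I) (by simpa [abs_le] using Ioc_subset_Icc_self hy)
      (by simpa using hrR n)
  have hbot := hf (-c) (by rw [abs_neg, abs_of_nonneg hc])
  have htop := hf c (abs_of_nonneg hc)
  have hlim := (((intervalIntegral_tendsto_integral hbot hR_neg hR).sub
    (intervalIntegral_tendsto_integral htop hR_neg hR)).add
      ((vertical R (hR.mono_right atTop_le_cocompact) fun n => rfl).const_mul I)).sub
      ((vertical (fun n => -R n) (hR_neg.mono_right atBot_le_cocompact)
        fun n => abs_neg _).const_mul I)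
  simpa only [rectIntegral, stripIntegral, mul_zero, add_zero, sub_zero] using hlim

end StripBoundary

/-- The closed strip of half-width `c` around the real axis. -/
def closedStrip (c : ℝ) : Set ℂ := {z | |z.im| ≤ c}

/-- The entire function `sin (π z / h)`, whose zeros are the points `k h` of the sinc grid. -/
noncomputable def latticeSin (h : ℝ) (z : ℂ) : ℂ := Complex.sin (π * z / h)

theorem norm_sin_sq (z : ℂ) :
    ‖Complex.sin z‖ ^ 2 = Real.sin z.re ^ 2 + Real.sinh z.im ^ 2 := by
  rw [Complex.sin_eq, ← Complex.ofReal_sin, ← Complex.ofReal_cos, ← Complex.ofReal_cosh,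
    ← Complex.ofReal_sinh, ← Complex.ofReal_mul, ← Complex.ofReal_mul, Complex.sq_norm,
    Complex.normSq_add_mul_I]
  nlinarith [Real.sin_sq_add_cos_sq z.re, Real.cosh_sq z.im]

theorem norm_cos_sq (z : ℂ) :
    ‖Complex.cos z‖ ^ 2 = Real.cos z.re ^ 2 + Real.sinh z.im ^ 2 := by
  rw [← Complex.sin_add_pi_div_two, norm_sin_sq]
  have hre : (z + π / 2).re = z.re + π / 2 := by simp
  have him : (z + π / 2).im = z.im := by simp
  rw [hre, him, Real.sin_add_pi_div_two]

theorem norm_cos_le_cosh (z : ℂ) : ‖Complex.cos z‖ ≤ Real.cosh z.im := by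
  refine le_of_sq_le_sq ?_ (Real.cosh_pos _).le
  rw [norm_cos_sq, Real.cosh_sq]
  linarith [Real.cos_sq_le_one z.re]

theorem abs_sinh_im_le_norm_sin (z : ℂ) : |Real.sinh z.im| ≤ ‖Complex.sin z‖ := by
  refine abs_le_of_sq_le_sq ?_ (norm_nonneg _)
  rw [norm_sin_sq]
  linarith [sq_nonneg (Real.sin z.re)]

theorem abs_sin_re_le_norm_sin (z : ℂ) : |Real.sin z.re| ≤ ‖Complex.sin z‖ := by
  refine abs_le_of_sq_le_sq ?_ (norm_nonneg _)
  rw [norm_sin_sq]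
  linarith [sq_nonneg (Real.sinh z.im)]

theorem convex_closedStrip (c : ℝ) : Convex ℝ (closedStrip c) := by
  have : closedStrip c = Complex.imCLM ⁻¹' Icc (-c) c := by
    ext z
    simp [closedStrip, abs_le]
  rw [this]
  exact (convex_Icc _ _).linear_preimage Complex.imCLM.toLinearMap

theorem reProdIm_subset_closedStrip (a b c : ℝ) : Icc a b ×ℂ Icc (-c) c ⊆ closedStrip c :=
  fun _ hz => abs_le.mpr hz.2

theorem closedStrip_subset_strip {c d : ℝ} (hcd : c < d) : closedStrip c ⊆ strip d :=
  fun _ hz => lt_of_le_of_lt hz hcd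

theorem ofReal_mem_strip {d : ℝ} (hd : 0 < d) (x : ℝ) : (x : ℂ) ∈ strip d := by
  simpa [strip] using hd

theorem ofReal_mem_closedStrip {c : ℝ} (hc : 0 ≤ c) (x : ℝ) : (x : ℂ) ∈ closedStrip c := by
  simpa [closedStrip] using hc

section LatticeSin

variable {h : ℝ}

theorem pi_mul_div_re (z : ℂ) : (π * z / h : ℂ).re = π * z.re / h := by
  rw [Complex.div_ofReal_re, Complex.re_ofReal_mul]

theorem pi_mul_div_im (z : ℂ) : (π * z / h : ℂ).im = π * z.im / h := by
  rw [Complex.div_ofReal_im, Complex.im_ofReal_mul]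

theorem hasDerivAt_latticeSin (z : ℂ) :
    HasDerivAt (latticeSin h) (Complex.cos (π * z / h) * (π / h)) z := by
  have hlinear : HasDerivAt (fun z : ℂ => (π * z / h : ℂ)) (π / h) z := by
    simpa using ((hasDerivAt_id z).const_mul (π : ℂ)).div_const (h : ℂ)
  exact hlinear.csin

theorem differentiable_latticeSin : Differentiable ℂ (latticeSin h) := fun z =>
  (hasDerivAt_latticeSin z).differentiableAt

theorem differentiable_dslope_latticeSin (p : ℂ) :
    Differentiable ℂ (dslope (latticeSin h) p) := by
  rw [← differentiableOn_univ, Complex.differentiableOn_dslope univ_mem]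
  exact differentiable_latticeSin.differentiableOn

theorem norm_latticeSin_ofReal_le_one (x : ℝ) : ‖latticeSin h x‖ ≤ 1 := by
  rw [latticeSin, ← Complex.ofReal_mul, ← Complex.ofReal_div, ← Complex.ofReal_sin,
    Complex.norm_real]
  exact Real.abs_sin_le_one _

theorem sinh_le_norm_latticeSin (hh : 0 < h) (z : ℂ) :
    Real.sinh (π * |z.im| / h) ≤ ‖latticeSin h z‖ := by
  have := abs_sinh_im_le_norm_sin (π * z / h)
  rwa [pi_mul_div_im, Real.abs_sinh, abs_div, abs_mul, abs_of_pos Real.pi_pos, abs_of_pos hh]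
    at this

theorem sinh_pi_mul_div_pos {c : ℝ} (hh : 0 < h) (hc : 0 < c) : 0 < Real.sinh (π * c / h) :=
  Real.sinh_pos_iff.mpr (by positivity)

theorem one_le_norm_latticeSin_of_re_eq (hh : h ≠ 0) (m : ℤ) {z : ℂ}
    (hz : z.re = (m + 1 / 2) * h) : 1 ≤ ‖latticeSin h z‖ := by
  refine le_trans ?_ (abs_sin_re_le_norm_sin _)
  have : π * ((m + 1 / 2) * h) / h = π / 2 + m * π := by
    field_simp
    ring
  rw [pi_mul_div_re, hz, this, Real.sin_add_int_mul_pi]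
  simp [abs_zpow]

theorem latticeSin_eq_zero_iff (hh : h ≠ 0) {z : ℂ} :
    latticeSin h z = 0 ↔ ∃ k : ℤ, z = ((k * h : ℝ) : ℂ) := by
  have hπ : (π : ℂ) ≠ 0 := by exact_mod_cast Real.pi_ne_zero
  have hh' : (h : ℂ) ≠ 0 := by exact_mod_cast hh
  rw [latticeSin, Complex.sin_eq_zero_iff]
  refine exists_congr fun k => ?_
  rw [div_eq_iff hh', Complex.ofReal_mul, Complex.ofReal_intCast, mul_right_comm,
    mul_comm (π : ℂ) z, mul_left_inj' hπ]

theorem neg_one_zpow_mul_self (k : ℤ) : (-1 : ℂ) ^ k * (-1) ^ k = 1 := by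
  rw [← mul_zpow]
  simp

theorem deriv_latticeSin_lattice (hh : h ≠ 0) (k : ℤ) :
    deriv (latticeSin h) ((k * h : ℝ) : ℂ) = (-1) ^ k * (π / h) := by
  have hangle : (π * ((k * h : ℝ) : ℂ) / h : ℂ) = ((k * π : ℝ) : ℂ) := by
    have : (h : ℂ) ≠ 0 := by exact_mod_cast hh
    push_cast
    field_simp
  rw [(hasDerivAt_latticeSin _).deriv, hangle, ← Complex.ofReal_cos, Real.cos_int_mul_pi]
  push_cast
  rfl

theorem sub_mul_dslope_latticeSin (hh : h ≠ 0) (k : ℤ) (z : ℂ) :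
    (z - ((k * h : ℝ) : ℂ)) * dslope (latticeSin h) ((k * h : ℝ) : ℂ) z = latticeSin h z := by
  rw [← smul_eq_mul, sub_smul_dslope, (latticeSin_eq_zero_iff hh).mpr ⟨k, rfl⟩, sub_zero]

theorem dslope_latticeSin_ne_zero (hh : 0 < h) {k : ℤ} {z : ℂ} (hz : |z.re - k * h| < h) :
    dslope (latticeSin h) ((k * h : ℝ) : ℂ) z ≠ 0 := by
  intro hzero
  have hsin : latticeSin h z = 0 := by
    rw [← sub_mul_dslope_latticeSin hh.ne' k, hzero, mul_zero]
  obtain ⟨m, rfl⟩ := (latticeSin_eq_zero_iff hh.ne').mp hsin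
  have hmk : |m - k| < 1 := by
    rw [Complex.ofReal_re, ← sub_mul, abs_mul, abs_of_pos hh] at hz
    exact_mod_cast (mul_lt_iff_lt_one_left hh).mp hz
  obtain rfl : m = k := sub_eq_zero.mp (Int.abs_lt_one_iff.mp hmk)
  rw [dslope_same, deriv_latticeSin_lattice hh.ne'] at hzero
  exact mul_ne_zero (zpow_ne_zero _ (by norm_num))
    (div_ne_zero (by exact_mod_cast Real.pi_ne_zero) (by exact_mod_cast hh.ne')) hzero

theorem norm_deriv_latticeSin_le (hh : 0 < h) {c : ℝ} {z : ℂ} (hz : z ∈ closedStrip c) :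
    ‖deriv (latticeSin h) z‖ ≤ Real.cosh (π * c / h) * (π / h) := by
  have hnorm : ‖(π / h : ℂ)‖ = π / h := by
    rw [← Complex.ofReal_div, Complex.norm_of_nonneg (by positivity)]
  have hcosh : Real.cosh (π * z.im / h) ≤ Real.cosh (π * c / h) := by
    rw [Real.cosh_le_cosh, abs_div, abs_div, abs_mul, abs_mul]
    have : |z.im| ≤ |c| := le_trans hz (le_abs_self c)
    gcongr
  rw [(hasDerivAt_latticeSin z).deriv, norm_mul, hnorm]
  refine mul_le_mul_of_nonneg_right ?_ (by positivity)
  exact (pi_mul_div_im (h := h) z ▸ norm_cos_le_cosh (π * z / h)).trans hcosh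

theorem norm_dslope_latticeSin_le (hh : 0 < h) {c : ℝ} {p z : ℂ} (hp : p ∈ closedStrip c)
    (hz : z ∈ closedStrip c) :
    ‖dslope (latticeSin h) p z‖ ≤ Real.cosh (π * c / h) * (π / h) := by
  rcases eq_or_ne z p with rfl | hne
  · rw [dslope_same]
    exact norm_deriv_latticeSin_le hh hz
  · have hlip := (convex_closedStrip c).norm_image_sub_le_of_norm_deriv_le
      (fun w _ => differentiable_latticeSin w) (fun w hw => norm_deriv_latticeSin_le hh hw) hp hz
    rw [dslope_of_ne _ hne, slope_def_field, norm_div,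
      div_le_iff₀ (norm_pos_iff.mpr (sub_ne_zero.mpr hne))]
    exact hlip

theorem dslope_latticeSin_lattice (hh : 0 < h) (x : ℝ) (k : ℤ) :
    (-1) ^ k * dslope (latticeSin h) x ((k * h : ℝ) : ℂ) =
      (π / h) * (Real.sinc (π * (x / h - k)) : ℂ) := by
  rcases eq_or_ne x (k * h) with rfl | hne
  · rw [dslope_same, deriv_latticeSin_lattice hh.ne', ← mul_assoc,
      neg_one_zpow_mul_self, mul_div_cancel_right₀ _ hh.ne', sub_self, mul_zero, Real.sinc_zero]
    simp
  · have hne' : ((k * h : ℝ) : ℂ) ≠ x := by exact_mod_cast hne.symm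
    have hu : x / h - k ≠ 0 := by
      rw [sub_ne_zero]
      exact fun hx => hne ((div_eq_iff hh.ne').mp hx)
    have hdiff : ((k * h : ℝ) : ℂ) - x = ((-(h * (x / h - k)) : ℝ) : ℂ) := by
      push_cast
      have : (h : ℂ) ≠ 0 := by exact_mod_cast hh.ne'
      field_simp
      ring
    have hsin : latticeSin h x = (-1) ^ k * (Real.sin (π * (x / h - k)) : ℂ) := by
      have hangle : π * x / h = π * (x / h - k) + k * π := by ring
      rw [latticeSin, ← Complex.ofReal_mul, ← Complex.ofReal_div, ← Complex.ofReal_sin, hangle,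
        Real.sin_add_int_mul_pi]
      push_cast
      rfl
    rw [dslope_of_ne _ hne', slope_def_field, (latticeSin_eq_zero_iff hh.ne').mpr ⟨k, rfl⟩,
      Real.sinc_of_ne_zero (mul_ne_zero Real.pi_ne_zero hu), hdiff, zero_sub, hsin]
    have : (h : ℂ) ≠ 0 := by exact_mod_cast hh.ne'
    have : ((x / h - k : ℝ) : ℂ) ≠ 0 := by exact_mod_cast hu
    generalize x / h - k = u at *
    push_cast
    field_simp
    linear_combination (Complex.sin (π * u)) * neg_one_zpow_mul_self k

theorem latticeSin_ne_zero_of_im_ne_zero (hh : h ≠ 0) {z : ℂ} (hz : z.im ≠ 0) :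
    latticeSin h z ≠ 0 := by
  rw [Ne, latticeSin_eq_zero_iff hh]
  rintro ⟨k, rfl⟩
  exact hz (Complex.ofReal_im _)

theorem latticeSin_ne_zero_of_mem_rectBoundary (hh : h ≠ 0) {c : ℝ} (hc : 0 < c) {a b : ℤ}
    {z : ℂ} (hz : z ∈ rectBoundary ((a + 1 / 2) * h) ((b + 1 / 2) * h) c) :
    latticeSin h z ≠ 0 := by
  have hside (m : ℤ) (hm : z.re = (m + 1 / 2) * h) : latticeSin h z ≠ 0 :=
    norm_pos_iff.mp (zero_lt_one.trans_le (one_le_norm_latticeSin_of_re_eq hh m hm))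
  rcases hz.2 with hre | hre | him
  · exact hside a hre
  · exact hside b hre
  · exact latticeSin_ne_zero_of_im_ne_zero hh (abs_pos.mp (him ▸ hc))

end LatticeSin

section Residues

variable {h c : ℝ} {A : ℂ → ℂ}

theorem rectIntegral_div_latticeSin_cell (hh : 0 < h) (hc : 0 < c)
    (hA : DifferentiableOn ℂ A (closedStrip c)) (k : ℤ) :
    rectIntegral (fun z => A z / latticeSin h z) ((k - 1 / 2) * h) ((k + 1 / 2) * h) c =
      2 * I * h * ((-1) ^ k * A ((k * h : ℝ) : ℂ)) := by
  have hmem : ((k * h : ℝ) : ℂ) ∈ Ioo ((k - 1 / 2) * h) ((k + 1 / 2) * h) ×ℂ Ioo (-c) c := by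
    rw [Complex.mem_reProdIm, Complex.ofReal_re, Complex.ofReal_im]
    exact ⟨⟨by linarith, by linarith⟩, by linarith, hc⟩
  have hslope : ∀ z ∈ Icc ((k - 1 / 2) * h) ((k + 1 / 2) * h) ×ℂ Icc (-c) c,
      dslope (latticeSin h) ((k * h : ℝ) : ℂ) z ≠ 0 := fun z ⟨⟨hz₁, hz₂⟩, _⟩ =>
    dslope_latticeSin_ne_zero hh (abs_lt.mpr ⟨by linarith, by linarith⟩)
  have hfactor : (fun z => A z / latticeSin h z) = fun z =>
      (A z / dslope (latticeSin h) ((k * h : ℝ) : ℂ) z) / (z - ((k * h : ℝ) : ℂ)) := by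
    funext z
    rw [div_div, mul_comm, sub_mul_dslope_latticeSin hh.ne']
  have hquot := (hA.mono (reProdIm_subset_closedStrip _ _ _)).fun_div
    (differentiable_dslope_latticeSin _).differentiableOn hslope
  rw [hfactor, rectIntegral_div_sub hmem hquot, dslope_same, deriv_latticeSin_lattice hh.ne']
  have : (-1 : ℂ) ^ k ≠ 0 := zpow_ne_zero _ (by norm_num)
  have : (h : ℂ) ≠ 0 := by exact_mod_cast hh.ne'
  have : (π : ℂ) ≠ 0 := by exact_mod_cast Real.pi_ne_zero
  field_simp
  linear_combination -(A ((k * h : ℝ) : ℂ)) * neg_one_zpow_mul_self k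

theorem rectIntegral_div_latticeSin (hh : 0 < h) (hc : 0 < c)
    (hA : DifferentiableOn ℂ A (closedStrip c)) {a b : ℤ} (hab : a ≤ b) :
    rectIntegral (fun z => A z / latticeSin h z) ((a + 1 / 2) * h) ((b + 1 / 2) * h) c =
      2 * I * h * ∑ k ∈ Finset.Ioc a b, (-1) ^ k * A ((k * h : ℝ) : ℂ) := by
  have hmono {a b : ℤ} (hab : a ≤ b) : ((a : ℝ) + 1 / 2) * h ≤ (b + 1 / 2) * h := by
    have : (a : ℝ) ≤ b := by exact_mod_cast hab
    gcongr
  have hcont (a b : ℤ) : ContinuousOn (fun z => A z / latticeSin h z)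
      (rectBoundary ((a + 1 / 2) * h) ((b + 1 / 2) * h) c) :=
    (hA.continuousOn.mono fun z hz => reProdIm_subset_closedStrip _ _ _ hz.1).div
      differentiable_latticeSin.continuous.continuousOn
      fun z hz => latticeSin_ne_zero_of_mem_rectBoundary hh.ne' hc hz
  induction b, hab using Int.leInduction with
  | base => simp [rectIntegral]
  | succ b hab ih =>
    have hcell := rectIntegral_div_latticeSin_cell hh hc hA (b + 1)
    have hleft : (((b + 1 : ℤ) : ℝ) - 1 / 2) * h = (b + 1 / 2) * h := by
      push_cast
      ring
    rw [hleft] at hcell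
    rw [← rectIntegral_add_adjacent (hmono hab) (hmono (by omega)) hc.le (hcont a b)
      (hcont b (b + 1)), ih, hcell, ← Finset.insert_Ioc_right_eq_Ioc_add_one hab,
      Finset.sum_insert (by simp)]
    ring

end Residues

/-- `F` is holomorphic on `S` and its modulus is dominated there by an integrable function `g` of
the real part that vanishes at infinity. -/
structure DominatedOn (F : ℂ → ℂ) (g : ℝ → ℝ) (S : Set ℂ) : Prop where
  differentiableOn : DifferentiableOn ℂ F S
  norm_le : ∀ z ∈ S, ‖F z‖ ≤ g z.re
  integrable : Integrable g
  tendsto_zero : Tendsto g (cocompact ℝ) (𝓝 0)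

/-- The kernel of the contour integral over the boundary of a strip that represents the error of
sinc interpolation with step `h` at the point `x`. -/
noncomputable def sincKernel (h x : ℝ) (z : ℂ) : ℂ :=
  (latticeSin h z)⁻¹ * (latticeSin h x * (z - x)⁻¹)

/-- The cardinal series (sinc interpolant) of `F` with step `h`. -/
noncomputable def cardinalSeries (F : ℂ → ℂ) (h x : ℝ) : ℂ :=
  ∑' k : ℤ, F ((k * h : ℝ) : ℂ) * (Real.sinc (π * (x / h - k)) : ℂ)

namespace DominatedOn

variable {F w : ℂ → ℂ} {g : ℝ → ℝ} {S T : Set ℂ} {c C : ℝ}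

theorem mono (hF : DominatedOn F g S) (hTS : T ⊆ S) : DominatedOn F g T where
  differentiableOn := hF.differentiableOn.mono hTS
  norm_le z hz := hF.norm_le z (hTS hz)
  integrable := hF.integrable
  tendsto_zero := hF.tendsto_zero

theorem mul_of_norm_le (hF : DominatedOn F g S) (hw : DifferentiableOn ℂ w S)
    (hC : ∀ z ∈ S, ‖w z‖ ≤ C) : DominatedOn (fun z => F z * w z) (fun t => g t * C) S where
  differentiableOn := hF.differentiableOn.mul hw
  norm_le z hz := by
    rw [norm_mul]
    exact mul_le_mul (hF.norm_le z hz) (hC z hz) (norm_nonneg _)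
      ((norm_nonneg _).trans (hF.norm_le z hz))
  integrable := hF.integrable.mul_const C
  tendsto_zero := by simpa only [zero_mul] using hF.tendsto_zero.mul_const C

theorem norm_line_le (hF : DominatedOn F g (closedStrip c)) {s : ℝ} (hs : |s| ≤ c) (t : ℝ) :
    ‖F (t + s * I)‖ ≤ g t := by
  simpa using hF.norm_le (t + s * I) (by simpa [closedStrip] using hs)

theorem continuous_line (hF : DominatedOn F g (closedStrip c)) {s : ℝ} (hs : |s| ≤ c) :
    Continuous fun t : ℝ => F (t + s * I) :=
  hF.differentiableOn.continuousOn.comp_continuous (by fun_prop) fun t => by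
    simpa [closedStrip] using hs

theorem norm_ofReal_le (hF : DominatedOn F g (closedStrip c)) (hc : 0 ≤ c) (t : ℝ) :
    ‖F t‖ ≤ g t :=
  hF.norm_le t (ofReal_mem_closedStrip hc t)

theorem continuous_ofReal (hF : DominatedOn F g (closedStrip c)) (hc : 0 ≤ c) :
    Continuous fun t : ℝ => F t :=
  hF.differentiableOn.continuousOn.comp_continuous (by fun_prop) (ofReal_mem_closedStrip hc)

theorem integrable_ofReal (hF : DominatedOn F g (closedStrip c)) (hc : 0 ≤ c) :
    Integrable fun t : ℝ => F t :=
  hF.integrable.mono' (hF.continuous_ofReal hc).aestronglyMeasurable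
    (ae_of_all _ (hF.norm_ofReal_le hc))

theorem stripIntegrable_mul (hF : DominatedOn F g (closedStrip c))
    (hw : ContinuousOn w (stripBoundary c)) (hC : ∀ z ∈ stripBoundary c, ‖w z‖ ≤ C) :
    StripIntegrable (fun z => F z * w z) c := by
  intro s hs
  have hw_line : Continuous fun t : ℝ => w (t + s * I) :=
    hw.comp_continuous (by fun_prop) (add_mul_I_mem_stripBoundary hs)
  refine (hF.integrable.mul_const C).mono'
    ((hF.continuous_line hs.le).mul hw_line).aestronglyMeasurable (ae_of_all _ fun t => ?_)
  have hFt := hF.norm_line_le hs.le t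
  rw [norm_mul]
  exact mul_le_mul hFt (hC _ (add_mul_I_mem_stripBoundary hs t)) (norm_nonneg _)
    ((norm_nonneg _).trans hFt)

end DominatedOn

section KernelBounds

variable {h c : ℝ}

theorem im_ne_zero_of_mem_stripBoundary (hc : 0 < c) {z : ℂ} (hz : z ∈ stripBoundary c) :
    z.im ≠ 0 :=
  abs_pos.mp (lt_of_lt_of_eq hc (Eq.symm hz))

theorem sub_ofReal_ne_zero {z : ℂ} (hz : z.im ≠ 0) (x : ℝ) : z - x ≠ 0 := by
  rw [sub_ne_zero]
  rintro rfl
  exact hz (Complex.ofReal_im x)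

theorem norm_inv_sub_ofReal_le {z : ℂ} (hz : z.im ≠ 0) (x : ℝ) : ‖(z - x)⁻¹‖ ≤ |z.im|⁻¹ := by
  rw [norm_inv]
  refine inv_anti₀ (abs_pos.mpr hz) ?_
  simpa using Complex.abs_im_le_norm (z - x)

theorem norm_inv_latticeSin_le (hh : 0 < h) {z : ℂ} (hz : z.im ≠ 0) :
    ‖(latticeSin h z)⁻¹‖ ≤ (Real.sinh (π * |z.im| / h))⁻¹ := by
  rw [norm_inv]
  exact inv_anti₀ (sinh_pi_mul_div_pos hh (abs_pos.mpr hz)) (sinh_le_norm_latticeSin hh z)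

theorem continuousOn_inv_latticeSin (hh : h ≠ 0) (hc : 0 < c) :
    ContinuousOn (fun z => (latticeSin h z)⁻¹) (stripBoundary c) :=
  differentiable_latticeSin.continuous.continuousOn.inv₀ fun _ hz =>
    latticeSin_ne_zero_of_im_ne_zero hh (im_ne_zero_of_mem_stripBoundary hc hz)

theorem continuousOn_inv_sub_ofReal (hc : 0 < c) (x : ℝ) :
    ContinuousOn (fun z : ℂ => (z - x)⁻¹) (stripBoundary c) :=
  ContinuousOn.inv₀ (by fun_prop) fun _ hz =>
    sub_ofReal_ne_zero (im_ne_zero_of_mem_stripBoundary hc hz) x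

theorem norm_sincKernel_le (hh : 0 < h) (hc : 0 < c) {z : ℂ} (hz : z ∈ stripBoundary c) (x : ℝ) :
    ‖sincKernel h x z‖ ≤ (Real.sinh (π * c / h))⁻¹ * c⁻¹ := by
  have him := im_ne_zero_of_mem_stripBoundary hc hz
  obtain rfl : |z.im| = c := hz
  have hsub : ‖latticeSin h x * (z - x)⁻¹‖ ≤ |z.im|⁻¹ := by
    rw [norm_mul]
    exact (mul_le_of_le_one_left (norm_nonneg _) (norm_latticeSin_ofReal_le_one x)).trans
      (norm_inv_sub_ofReal_le him x)
  rw [sincKernel, norm_mul]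
  exact mul_le_mul (norm_inv_latticeSin_le hh him) hsub (norm_nonneg _)
    (inv_nonneg.mpr (sinh_pi_mul_div_pos hh hc).le)

theorem continuousOn_sincKernel (hh : h ≠ 0) (hc : 0 < c) (x : ℝ) :
    ContinuousOn (sincKernel h x) (stripBoundary c) :=
  (continuousOn_inv_latticeSin hh hc).mul
    (continuousOn_const.mul (continuousOn_inv_sub_ofReal hc x))

end KernelBounds

section StripFormulas

variable {h c : ℝ} {F : ℂ → ℂ} {g : ℝ → ℝ}

theorem stripIntegrable_div_latticeSin (hh : 0 < h) (hc : 0 < c)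
    (hF : DominatedOn F g (closedStrip c)) :
    StripIntegrable (fun z => F z / latticeSin h z) c := by
  simp only [div_eq_mul_inv]
  refine hF.stripIntegrable_mul (C := (Real.sinh (π * c / h))⁻¹)
    (continuousOn_inv_latticeSin hh.ne' hc) fun z hz => ?_
  have := norm_inv_latticeSin_le hh (im_ne_zero_of_mem_stripBoundary hc hz)
  rwa [show |z.im| = c from hz] at this

theorem stripIntegrable_div_sub_ofReal (hc : 0 < c) (hF : DominatedOn F g (closedStrip c))
    (x : ℝ) : StripIntegrable (fun z => F z / (z - x)) c := by
  simp only [div_eq_mul_inv]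
  refine hF.stripIntegrable_mul (C := c⁻¹) (continuousOn_inv_sub_ofReal hc x) fun z hz => ?_
  have := norm_inv_sub_ofReal_le (im_ne_zero_of_mem_stripBoundary hc hz) x
  rwa [show |z.im| = c from hz] at this

theorem stripIntegral_div_latticeSin (hh : 0 < h) (hc : 0 < c)
    (hF : DominatedOn F g (closedStrip c)) (hsum : Summable fun k : ℤ => F ((k * h : ℝ) : ℂ)) :
    stripIntegral (fun z => F z / latticeSin h z) c =
      2 * I * h * ∑' k : ℤ, (-1) ^ k * F ((k * h : ℝ) : ℂ) := by
  have hR : Tendsto (fun n : ℕ => ((n : ℝ) + 1 / 2) * h) atTop atTop :=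
    (tendsto_atTop_add_const_right _ _ tendsto_natCast_atTop_atTop).atTop_mul_const hh
  have hside (n : ℕ) (z : ℂ) (hz : |z.im| ≤ c) (hre : |z.re| = |((n : ℝ) + 1 / 2) * h|) :
      ‖F z / latticeSin h z‖ ≤ g z.re := by
    obtain ⟨m, hm⟩ : ∃ m : ℤ, z.re = (m + 1 / 2) * h := by
      rcases abs_eq_abs.mp hre with hpos | hneg
      · exact ⟨n, by simpa using hpos⟩
      · refine ⟨-n - 1, hneg.trans ?_⟩
        push_cast
        ring
    rw [norm_div]
    exact (div_le_self (norm_nonneg _) (one_le_norm_latticeSin_of_re_eq hh.ne' m hm)).trans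
      (hF.norm_le z hz)
  have hrect := tendsto_rectIntegral hc.le hR hF.tendsto_zero
    (stripIntegrable_div_latticeSin hh hc hF) hside
  have hsum_alt : Summable fun k : ℤ => (-1 : ℂ) ^ k * F ((k * h : ℝ) : ℂ) :=
    Summable.of_norm_bounded hsum.norm fun k => by simp
  have hexhaust : Tendsto (fun n : ℕ => Finset.Ioc (-(n : ℤ) - 1) n) atTop atTop := by
    refine Monotone.tendsto_atTop_finset (fun m n hmn => ?_) fun k => ⟨k.natAbs, ?_⟩
    · exact Finset.Ioc_subset_Ioc (by omega) (by omega)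
    · rw [Finset.mem_Ioc]
      omega
  have hpartial := (hsum_alt.hasSum.comp hexhaust).const_mul (2 * I * h)
  refine tendsto_nhds_unique hrect (hpartial.congr fun n => ?_)
  have hleft : (((-(n : ℤ) - 1 : ℤ) : ℝ) + 1 / 2) * h = -((n + 1 / 2) * h) := by
    push_cast
    ring
  have := rectIntegral_div_latticeSin hh hc hF.differentiableOn
    (a := -(n : ℤ) - 1) (b := n) (by omega)
  rw [hleft, Int.cast_natCast] at this
  exact this.symm

theorem stripIntegral_div_sub_ofReal (hc : 0 < c) (hF : DominatedOn F g (closedStrip c))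
    (x : ℝ) : stripIntegral (fun z => F z / (z - x)) c = 2 * π * I * F x := by
  have hR : Tendsto (fun n : ℕ => (n : ℝ) + (|x| + 1)) atTop atTop :=
    tendsto_atTop_add_const_right _ _ tendsto_natCast_atTop_atTop
  have hside (n : ℕ) (z : ℂ) (hz : |z.im| ≤ c) (hre : |z.re| = |(n : ℝ) + (|x| + 1)|) :
      ‖F z / (z - x)‖ ≤ g z.re := by
    have hdist : 1 ≤ |z.re - x| := by
      have hR_pos : 0 < (n : ℝ) + (|x| + 1) := by positivity
      rw [abs_of_pos hR_pos] at hre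
      have : (0 : ℝ) ≤ n := Nat.cast_nonneg n
      linarith [abs_sub_abs_le_abs_sub z.re x]
    have hre_le : |z.re - x| ≤ ‖z - x‖ := by simpa using Complex.abs_re_le_norm (z - x)
    rw [norm_div]
    exact (div_le_self (norm_nonneg _) (hdist.trans hre_le)).trans (hF.norm_le z hz)
  have hrect := tendsto_rectIntegral hc.le hR hF.tendsto_zero
    (stripIntegrable_div_sub_ofReal hc hF x) hside
  refine tendsto_nhds_unique hrect (tendsto_const_nhds.congr fun n => ?_)
  have : (0 : ℝ) ≤ n := Nat.cast_nonneg n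
  have hx : (x : ℂ) ∈ Ioo (-((n : ℝ) + (|x| + 1))) (n + (|x| + 1)) ×ℂ Ioo (-c) c := by
    rw [Complex.mem_reProdIm, Complex.ofReal_re, Complex.ofReal_im]
    exact ⟨⟨by linarith [neg_abs_le x], by linarith [le_abs_self x]⟩, by linarith, hc⟩
  exact (rectIntegral_div_sub hx
    (hF.differentiableOn.mono (reProdIm_subset_closedStrip _ _ _))).symm

theorem stripIntegral_mul_dslope_div_latticeSin (hh : 0 < h) (hc : 0 < c)
    (hF : DominatedOn F g (closedStrip c)) (x : ℝ) :
    stripIntegral (fun z => F z * dslope (latticeSin h) x z / latticeSin h z) c =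
      stripIntegral (fun z => F z / (z - x)) c -
        stripIntegral (fun z => F z * sincKernel h x z) c := by
  rw [← stripIntegral_sub hc.le (stripIntegrable_div_sub_ofReal hc hF x)
    (hF.stripIntegrable_mul (continuousOn_sincKernel hh.ne' hc x) fun z hz =>
      norm_sincKernel_le hh hc hz x)]
  refine stripIntegral_congr hc.le fun z hz => ?_
  have him := im_ne_zero_of_mem_stripBoundary hc hz
  have hsub := sub_ofReal_ne_zero him x
  have hsin := latticeSin_ne_zero_of_im_ne_zero hh.ne' him
  simp only [sincKernel, dslope_of_ne _ (sub_ne_zero.mp hsub), slope_def_field]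
  field_simp

theorem sinc_interpolation_error (hh : 0 < h) (hc : 0 < c)
    (hF : DominatedOn F g (closedStrip c)) (hsum : Summable fun k : ℤ => F ((k * h : ℝ) : ℂ))
    (x : ℝ) :
    2 * π * I * (F x - cardinalSeries F h x) =
      stripIntegral (fun z => F z * sincKernel h x z) c := by
  have hslope (z : ℂ) (hz : z ∈ closedStrip c) := norm_dslope_latticeSin_le hh
    (ofReal_mem_closedStrip hc.le x) hz
  have hF_slope := hF.mul_of_norm_le
    (differentiable_dslope_latticeSin (h := h) x).differentiableOn hslope
  have hsum_slope : Summable fun k : ℤ =>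
      F ((k * h : ℝ) : ℂ) * dslope (latticeSin h) x ((k * h : ℝ) : ℂ) := by
    refine Summable.of_norm_bounded
      (hsum.norm.mul_right (Real.cosh (π * c / h) * (π / h))) fun k => ?_
    rw [norm_mul]
    exact mul_le_mul_of_nonneg_left (hslope _ (ofReal_mem_closedStrip hc.le _)) (norm_nonneg _)
  have hlattice := stripIntegral_div_latticeSin hh hc hF_slope hsum_slope
  have hseries : ∑' k : ℤ, (-1) ^ k *
      (F ((k * h : ℝ) : ℂ) * dslope (latticeSin h) x ((k * h : ℝ) : ℂ)) =
      (π / h) * cardinalSeries F h x := by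
    rw [cardinalSeries, ← tsum_mul_left]
    refine tsum_congr fun k => ?_
    linear_combination (F ((k * h : ℝ) : ℂ)) * dslope_latticeSin_lattice hh x k
  have hcancel : 2 * I * h * ((π / h) * cardinalSeries F h x) =
      2 * π * I * cardinalSeries F h x := by
    have : (h : ℂ) ≠ 0 := by exact_mod_cast hh.ne'
    field_simp
  rw [stripIntegral_mul_dslope_div_latticeSin hh hc hF, stripIntegral_div_sub_ofReal hc hF,
    hseries, hcancel] at hlattice
  linear_combination hlattice

end StripFormulas

section KernelIntegral

variable {h c : ℝ} {z : ℂ}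

theorem hasDerivAt_inv_sub_ofReal (hz : z.im ≠ 0) (x : ℝ) :
    HasDerivAt (fun x : ℝ => (z - x)⁻¹) ((z - x)⁻¹ ^ 2) x := by
  have hsub : HasDerivAt (fun x : ℂ => z - x) (-1) (x : ℂ) := (hasDerivAt_id _).const_sub z
  refine (hsub.inv (sub_ofReal_ne_zero hz x)).comp_ofReal.congr_deriv ?_
  rw [neg_neg, one_div, inv_pow]

theorem continuous_inv_sub_ofReal (hz : z.im ≠ 0) : Continuous fun x : ℝ => (z - x)⁻¹ :=
  continuous_iff_continuousAt.mpr fun x => (hasDerivAt_inv_sub_ofReal hz x).continuousAt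

theorem hasDerivAt_cos_div (hh : h ≠ 0) (x : ℝ) :
    HasDerivAt (fun x : ℝ => -(h / π * Complex.cos (π * x / h))) (latticeSin h x) x := by
  have hπ : (π : ℂ) ≠ 0 := by exact_mod_cast Real.pi_ne_zero
  have hh' : (h : ℂ) ≠ 0 := by exact_mod_cast hh
  have hlinear : HasDerivAt (fun z : ℂ => (π * z / h : ℂ)) (π / h) (x : ℂ) := by
    simpa using ((hasDerivAt_id (x : ℂ)).const_mul (π : ℂ)).div_const (h : ℂ)
  refine ((hlinear.ccos.const_mul (h / π : ℂ)).neg.comp_ofReal).congr_deriv ?_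
  rw [latticeSin]
  field_simp

theorem norm_cos_div_le (hh : 0 < h) (x : ℝ) :
    ‖-(h / π * Complex.cos (π * x / h))‖ ≤ h / π := by
  have hcos : ‖Complex.cos (π * x / h)‖ ≤ 1 := by
    rw [← Complex.ofReal_mul, ← Complex.ofReal_div, ← Complex.ofReal_cos, Complex.norm_real]
    exact Real.abs_cos_le_one _
  rw [norm_neg, norm_mul, ← Complex.ofReal_div, Complex.norm_of_nonneg (by positivity)]
  exact mul_le_of_le_one_right (by positivity) hcos

theorem inv_sqrt_one_add_sq_le_arctan (w : ℝ) : (√(1 + w ^ 2))⁻¹ ≤ π / 2 - Real.arctan w := by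
  rw [← one_div, ← Real.cos_arctan, ← Real.sin_pi_div_two_sub]
  exact Real.sin_le (by linarith [Real.arctan_lt_pi_div_two w])

theorem norm_inv_sub_ofReal (hz : z.im ≠ 0) (x : ℝ) :
    ‖(z - x)⁻¹‖ = |z.im|⁻¹ * (√(1 + ((x - z.re) / |z.im|) ^ 2))⁻¹ := by
  have hpos : 0 < |z.im| := abs_pos.mpr hz
  rw [norm_inv, Complex.norm_eq_sqrt_sq_add_sq, ← mul_inv]
  congr 1
  have hscale : (z - x).re ^ 2 + (z - x).im ^ 2 =
      |z.im| ^ 2 * (1 + ((x - z.re) / |z.im|) ^ 2) := by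
    rw [Complex.sub_re, Complex.sub_im, Complex.ofReal_re, Complex.ofReal_im, sub_zero,
      ← sq_abs z.im]
    field_simp
    ring
  rw [hscale, Real.sqrt_mul (sq_nonneg _), Real.sqrt_sq hpos.le]

theorem norm_inv_sub_ofReal_le_sub_arctan (hz : z.im ≠ 0) (x : ℝ) :
    ‖(z - x)⁻¹‖ ≤ |z.im|⁻¹ * (π / 2 - Real.arctan ((x - z.re) / |z.im|)) := by
  rw [norm_inv_sub_ofReal hz]
  exact mul_le_mul_of_nonneg_left (inv_sqrt_one_add_sq_le_arctan _) (by positivity)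

theorem norm_inv_sub_ofReal_le_add_arctan (hz : z.im ≠ 0) (x : ℝ) :
    ‖(z - x)⁻¹‖ ≤ |z.im|⁻¹ * (π / 2 + Real.arctan ((x - z.re) / |z.im|)) := by
  have := inv_sqrt_one_add_sq_le_arctan (-((x - z.re) / |z.im|))
  rw [neg_sq, Real.arctan_neg, sub_neg_eq_add] at this
  rw [norm_inv_sub_ofReal hz]
  exact mul_le_mul_of_nonneg_left this (by positivity)

theorem integral_norm_inv_sub_sq (hz : z.im ≠ 0) (a b : ℝ) :
    ∫ x in a..b, ‖(z - x)⁻¹‖ ^ 2 = |z.im|⁻¹ * Real.arctan ((b - z.re) / |z.im|) -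
      |z.im|⁻¹ * Real.arctan ((a - z.re) / |z.im|) := by
  refine intervalIntegral.integral_eq_sub_of_hasDerivAt
    (f := fun x => |z.im|⁻¹ * Real.arctan ((x - z.re) / |z.im|)) (fun x _ => ?_)
    (((continuous_inv_sub_ofReal hz).norm.pow 2).intervalIntegrable _ _)
  have hlinear : HasDerivAt (fun x : ℝ => (x - z.re) / |z.im|) (1 / |z.im|) x :=
    ((hasDerivAt_id x).sub_const _).div_const _
  refine (hlinear.arctan.const_mul |z.im|⁻¹).congr_deriv ?_
  rw [norm_inv_sub_ofReal hz, mul_pow, inv_pow (√_), Real.sq_sqrt (by positivity)]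
  ring

-- Integrating the oscillating factor by parts gains the factor `h`; the boundary terms and the
-- remaining integral combine through `arctan` to a bound that does not depend on `a` and `b`.
theorem norm_integral_latticeSin_mul_inv_sub_le (hh : 0 < h) (hz : z.im ≠ 0) {a b : ℝ}
    (hab : a ≤ b) : ‖∫ x in a..b, latticeSin h x * (z - x)⁻¹‖ ≤ h / |z.im| := by
  have hinv := continuous_inv_sub_ofReal hz
  have hsin : Continuous fun x : ℝ => latticeSin h x :=
    differentiable_latticeSin.continuous.comp Complex.continuous_ofReal
  have hparts := intervalIntegral.integral_mul_deriv_eq_deriv_mul (a := a) (b := b)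
    (fun x _ => hasDerivAt_inv_sub_ofReal hz x) (fun x _ => hasDerivAt_cos_div hh.ne' x)
    ((hinv.pow 2).intervalIntegrable _ _) (hsin.intervalIntegrable _ _)
  have hremainder : ‖∫ x in a..b, (z - x)⁻¹ ^ 2 * -(h / π * Complex.cos (π * x / h))‖ ≤
      (∫ x in a..b, ‖(z - x)⁻¹‖ ^ 2) * (h / π) := by
    rw [← intervalIntegral.integral_mul_const]
    refine intervalIntegral.norm_integral_le_of_norm_le hab (ae_of_all _ fun x _ => ?_)
      (((hinv.norm.pow 2).mul continuous_const).intervalIntegrable _ _)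
    rw [norm_mul, norm_pow]
    exact mul_le_mul_of_nonneg_left (norm_cos_div_le hh x) (by positivity)
  have hright := norm_inv_sub_ofReal_le_sub_arctan hz b
  have hleft := norm_inv_sub_ofReal_le_add_arctan hz a
  have : 0 < |z.im| := abs_pos.mpr hz
  simp only [mul_comm (latticeSin h _)]
  rw [hparts]
  calc _ ≤ ‖(z - b)⁻¹‖ * (h / π) + ‖(z - a)⁻¹‖ * (h / π) +
        (∫ x in a..b, ‖(z - x)⁻¹‖ ^ 2) * (h / π) := by
        refine (norm_sub_le _ _).trans (add_le_add ((norm_sub_le _ _).trans ?_) hremainder)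
        rw [norm_mul, norm_mul]
        gcongr <;> exact norm_cos_div_le hh _
    _ ≤ |z.im|⁻¹ * (π / 2 - Real.arctan ((b - z.re) / |z.im|)) * (h / π) +
        |z.im|⁻¹ * (π / 2 + Real.arctan ((a - z.re) / |z.im|)) * (h / π) +
        (∫ x in a..b, ‖(z - x)⁻¹‖ ^ 2) * (h / π) := by gcongr
    _ = h / |z.im| := by
        rw [integral_norm_inv_sub_sq hz]
        field_simp
        ring

theorem norm_integral_sincKernel_le (hh : 0 < h) (hc : 0 < c) (hz : z ∈ stripBoundary c)
    {a b : ℝ} (hab : a ≤ b) :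
    ‖∫ x in a..b, sincKernel h x z‖ ≤ (Real.sinh (π * c / h))⁻¹ * (h / c) := by
  have him := im_ne_zero_of_mem_stripBoundary hc hz
  obtain rfl : |z.im| = c := hz
  simp only [sincKernel]
  rw [intervalIntegral.integral_const_mul, norm_mul]
  exact mul_le_mul (norm_inv_latticeSin_le hh him)
    (norm_integral_latticeSin_mul_inv_sub_le hh him hab) (norm_nonneg _)
    (inv_nonneg.mpr (sinh_pi_mul_div_pos hh hc).le)

end KernelIntegral

section IndefiniteIntegral

variable {h c : ℝ} {F : ℂ → ℂ} {g : ℝ → ℝ}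

theorem continuous_sincKernel_line (hh : h ≠ 0) (hc : 0 < c) {s : ℝ} (hs : |s| = c) :
    Continuous fun p : ℝ × ℝ => sincKernel h p.1 (p.2 + s * I) := by
  have hmem (p : ℝ × ℝ) := add_mul_I_mem_stripBoundary hs p.2
  have hinv_sin : Continuous fun p : ℝ × ℝ => (latticeSin h (p.2 + s * I))⁻¹ :=
    (continuousOn_inv_latticeSin hh hc).comp_continuous (by fun_prop) hmem
  have hinv_sub : Continuous fun p : ℝ × ℝ => (p.2 + s * I - p.1 : ℂ)⁻¹ :=
    Continuous.inv₀ (by fun_prop) fun p =>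
      sub_ofReal_ne_zero (im_ne_zero_of_mem_stripBoundary hc (hmem p)) p.1
  have hsin : Continuous fun p : ℝ × ℝ => latticeSin h p.1 :=
    differentiable_latticeSin.continuous.comp (by fun_prop)
  exact hinv_sin.mul (hsin.mul hinv_sub)

theorem integrable_uncurry_mul_sincKernel (hh : 0 < h) (hc : 0 < c)
    (hF : DominatedOn F g (closedStrip c)) {s : ℝ} (hs : |s| = c) (a b : ℝ) :
    Integrable (Function.uncurry fun x t : ℝ => F (t + s * I) * sincKernel h x (t + s * I))
      ((volume.restrict (uIoc a b)).prod volume) := by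
  have : IsFiniteMeasure (volume.restrict (uIoc a b)) :=
    inferInstanceAs (IsFiniteMeasure (volume.restrict (Ioc _ _)))
  refine ((hF.integrable.comp_snd _).mul_const ((Real.sinh (π * c / h))⁻¹ * c⁻¹)).mono'
    (Continuous.aestronglyMeasurable ?_) (ae_of_all _ fun p => ?_)
  · exact ((hF.continuous_line hs.le).comp continuous_snd).mul
      (continuous_sincKernel_line hh.ne' hc hs)
  · rw [Function.uncurry_def, norm_mul]
    have hFp := hF.norm_line_le hs.le p.2
    exact mul_le_mul hFp (norm_sincKernel_le hh hc (add_mul_I_mem_stripBoundary hs p.2) p.1)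
      (norm_nonneg _) ((norm_nonneg _).trans hFp)

theorem norm_integral_line_mul_sincKernel_le (hh : 0 < h) (hc : 0 < c)
    (hF : DominatedOn F g (closedStrip c)) {s : ℝ} (hs : |s| = c) {a b : ℝ} (hab : a ≤ b) :
    ‖∫ x in a..b, ∫ t : ℝ, F (t + s * I) * sincKernel h x (t + s * I)‖ ≤
      (∫ t, g t) * ((Real.sinh (π * c / h))⁻¹ * (h / c)) := by
  rw [intervalIntegral_integral_swap (integrable_uncurry_mul_sincKernel hh hc hF hs a b),
    ← integral_mul_const]
  refine norm_integral_le_of_norm_le (hF.integrable.mul_const _) (ae_of_all _ fun t => ?_)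
  rw [intervalIntegral.integral_const_mul, norm_mul]
  have hFt := hF.norm_line_le hs.le t
  exact mul_le_mul hFt
    (norm_integral_sincKernel_le hh hc (add_mul_I_mem_stripBoundary hs t) hab)
    (norm_nonneg _) ((norm_nonneg _).trans hFt)

theorem norm_integral_stripIntegral_le (hh : 0 < h) (hc : 0 < c)
    (hF : DominatedOn F g (closedStrip c)) {a b : ℝ} (hab : a ≤ b) :
    ‖∫ x in a..b, stripIntegral (fun z => F z * sincKernel h x z) c‖ ≤
      2 * ((∫ t, g t) * ((Real.sinh (π * c / h))⁻¹ * (h / c))) := by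
  have hcneg : |-c| = c := by rw [abs_neg, abs_of_pos hc]
  have hcpos : |c| = c := abs_of_pos hc
  have hint (s : ℝ) (hs : |s| = c) : IntervalIntegrable
      (fun x => ∫ t : ℝ, F (t + s * I) * sincKernel h x (t + s * I)) volume a b := by
    rw [intervalIntegrable_iff]
    exact (integrable_uncurry_mul_sincKernel hh hc hF hs a b).integral_prod_left
  simp only [stripIntegral]
  rw [intervalIntegral.integral_sub (hint _ hcneg) (hint _ hcpos), two_mul]
  exact (norm_sub_le _ _).trans
    (add_le_add (norm_integral_line_mul_sincKernel_le hh hc hF hcneg hab)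
      (norm_integral_line_mul_sincKernel_le hh hc hF hcpos hab))

theorem norm_mul_sinc_le (w : ℂ) (x : ℝ) : ‖w * (Real.sinc x : ℂ)‖ ≤ ‖w‖ := by
  rw [norm_mul, Complex.norm_real]
  exact mul_le_of_le_one_right (norm_nonneg _) (Real.abs_sinc_le_one _)

theorem continuous_cardinalSeries_term (w : ℂ) (k : ℤ) :
    Continuous fun x : ℝ => w * (Real.sinc (π * (x / h - k)) : ℂ) := by
  have : Continuous fun x : ℝ => Real.sinc (π * (x / h - k)) :=
    Real.continuous_sinc.comp (by fun_prop)
  fun_prop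

theorem continuous_cardinalSeries (hsum : Summable fun k : ℤ => F ((k * h : ℝ) : ℂ)) :
    Continuous (cardinalSeries F h) :=
  continuous_tsum (fun k => continuous_cardinalSeries_term _ k) hsum.norm
    fun _ _ => norm_mul_sinc_le _ _

theorem integral_cardinalSeries (hh : 0 < h) (hsum : Summable fun k : ℤ => F ((k * h : ℝ) : ℂ))
    (a b : ℝ) : ∫ x in a..b, cardinalSeries F h x =
      ∑' k : ℤ, F ((k * h : ℝ) : ℂ) * ((J k h b - J k h a : ℝ) : ℂ) := by
  have hswap := intervalIntegral.hasSum_integral_of_dominated_convergence (a := a) (b := b)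
    (μ := volume) (f := cardinalSeries F h)
    (F := fun (k : ℤ) (x : ℝ) => F ((k * h : ℝ) : ℂ) * (Real.sinc (π * (x / h - k)) : ℂ))
    (fun k _ => ‖F ((k * h : ℝ) : ℂ)‖)
    (fun k => (continuous_cardinalSeries_term _ k).aestronglyMeasurable)
    (fun k => ae_of_all _ fun x _ => norm_mul_sinc_le _ _) (ae_of_all _ fun _ _ => hsum.norm)
    (continuous_const.intervalIntegrable _ _)
    (ae_of_all _ fun x _ =>
      (Summable.of_norm_bounded hsum.norm fun k => norm_mul_sinc_le _ _).hasSum)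
  rw [← hswap.tsum_eq]
  refine tsum_congr fun k => ?_
  rw [intervalIntegral.integral_const_mul, intervalIntegral.integral_ofReal,
    integral_sinc_eq_J_sub k hh]

theorem norm_integral_sub_tsum_J_le (hh : 0 < h) (hc : 0 < c)
    (hF : DominatedOn F g (closedStrip c)) (hsum : Summable fun k : ℤ => F ((k * h : ℝ) : ℂ))
    {a b : ℝ} (hab : a ≤ b) :
    ‖(∫ x in a..b, F x) - ∑' k : ℤ, F ((k * h : ℝ) : ℂ) * ((J k h b - J k h a : ℝ) : ℂ)‖ ≤
      (∫ t, g t) / π * ((Real.sinh (π * c / h))⁻¹ * (h / c)) := by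
  have htwo_pi : ‖(2 * π * I : ℂ)‖ = 2 * π := by simp [abs_of_pos Real.pi_pos]
  have herror : 2 * π * ‖∫ x in a..b, (F x - cardinalSeries F h x)‖ ≤
      2 * ((∫ t, g t) * ((Real.sinh (π * c / h))⁻¹ * (h / c))) := by
    rw [← htwo_pi, ← norm_mul, ← intervalIntegral.integral_const_mul]
    simp only [sinc_interpolation_error hh hc hF hsum]
    exact norm_integral_stripIntegral_le hh hc hF hab
  rw [← integral_cardinalSeries hh hsum, ← intervalIntegral.integral_sub
    ((hF.continuous_ofReal hc.le).intervalIntegrable _ _)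
    ((continuous_cardinalSeries hsum).intervalIntegrable _ _),
    div_mul_eq_mul_div, le_div_iff₀ Real.pi_pos]
  linarith

theorem tendsto_tsum_mul_J_sub (hh : 0 < h) {u : ℤ → ℂ} (hu : Summable u) (ξ : ℝ) :
    Tendsto (fun a : ℝ => ∑' k : ℤ, u k * ((J k h ξ - J k h a : ℝ) : ℂ)) atBot
      (𝓝 (∑' k : ℤ, u k * (J k h ξ : ℂ))) := by
  refine tendsto_tsum_of_dominated_convergence (hu.norm.mul_right (3 * h)) (fun k => ?_)
    (Eventually.of_forall fun a k => ?_)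
  · have hJ : Tendsto (fun a => J k h ξ - J k h a) atBot (𝓝 (J k h ξ)) := by
      simpa only [sub_zero] using tendsto_const_nhds.sub (tendsto_J_atBot k hh)
    exact ((Complex.continuous_ofReal.tendsto _).comp hJ).const_mul _
  · have hbound : |J k h ξ - J k h a| ≤ 3 * h := by
      linarith [abs_sub (J k h ξ) (J k h a), abs_J_le k hh ξ, abs_J_le k hh a]
    rw [norm_mul, Complex.norm_real]
    exact mul_le_mul_of_nonneg_left hbound (norm_nonneg _)

theorem norm_integral_Iic_sub_tsum_J_le (hh : 0 < h) (hc : 0 < c)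
    (hF : DominatedOn F g (closedStrip c)) (hsum : Summable fun k : ℤ => F ((k * h : ℝ) : ℂ))
    (ξ : ℝ) : ‖(∫ x in Iic ξ, F x) - ∑' k : ℤ, F ((k * h : ℝ) : ℂ) * (J k h ξ : ℂ)‖ ≤
      (∫ t, g t) / π * ((Real.sinh (π * c / h))⁻¹ * (h / c)) := by
  have hintegral := intervalIntegral_tendsto_integral_Iic (μ := volume) ξ
    (hF.integrable_ofReal hc.le).integrableOn (tendsto_id (x := (atBot : Filter ℝ)))
  refine le_of_tendsto (hintegral.sub (tendsto_tsum_mul_J_sub hh hsum ξ)).norm ?_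
  filter_upwards [eventually_le_atBot ξ] with a ha
  exact norm_integral_sub_tsum_J_le hh hc hF hsum ha

theorem norm_integral_Iic_sub_tsum_J_le_of_strip {d : ℝ} (hh : 0 < h) (hd : 0 < d)
    (hF : DominatedOn F g (strip d)) (hsum : Summable fun k : ℤ => F ((k * h : ℝ) : ℂ))
    (ξ : ℝ) : ‖(∫ x in Iic ξ, F x) - ∑' k : ℤ, F ((k * h : ℝ) : ℂ) * (J k h ξ : ℂ)‖ ≤
      (∫ t, g t) / π * ((Real.sinh (π * d / h))⁻¹ * (h / d)) := by
  have hsinh : ContinuousAt (fun c : ℝ => (Real.sinh (π * c / h))⁻¹) d :=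
    ContinuousAt.inv₀ (Real.continuous_sinh.comp (by fun_prop)).continuousAt
      (sinh_pi_mul_div_pos hh hd).ne'
  have hbound : ContinuousAt (fun c : ℝ => (∫ t, g t) / π *
      ((Real.sinh (π * c / h))⁻¹ * (h / c))) d :=
    continuousAt_const.mul (hsinh.mul (continuousAt_const.div continuousAt_id hd.ne'))
  refine ge_of_tendsto (hbound.tendsto.mono_left (nhdsWithin_le_nhds (s := Iio d))) ?_
  filter_upwards [nhdsWithin_le_nhds (eventually_gt_nhds hd), self_mem_nhdsWithin] with c hc hcd
  exact norm_integral_Iic_sub_tsum_J_le hh hc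
    (hF.mono (closedStrip_subset_strip hcd)) hsum ξ

end IndefiniteIntegral

section HyperbolicInequalities

theorem abs_le_abs_sinh (x : ℝ) : |x| ≤ |Real.sinh x| := by
  rw [Real.abs_sinh]
  exact Real.self_le_sinh_iff.mpr (abs_nonneg x)

theorem one_add_sq_div_two_le_cosh (x : ℝ) : 1 + x ^ 2 / 2 ≤ Real.cosh x := by
  have hhalf : Real.cosh x = 1 + 2 * Real.sinh (x / 2) ^ 2 := by
    have := Real.cosh_two_mul (x / 2)
    rw [mul_div_cancel₀ x two_ne_zero, Real.cosh_sq] at this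
    linarith
  have := sq_le_sq.mpr (abs_le_abs_sinh (x / 2))
  linarith

theorem exp_abs_le_two_mul_cosh (x : ℝ) : Real.exp |x| ≤ 2 * Real.cosh x := by
  rw [Real.cosh_eq]
  linarith [Real.exp_abs_le x]

theorem cosh_le_cosh_add_sinh_sub {x t : ℝ} (hxt : x ≤ t) :
    Real.cosh t ≤ Real.cosh x + (Real.sinh t - Real.sinh x) := by
  have := Real.exp_le_exp.mpr (neg_le_neg hxt)
  linarith [Real.cosh_sub_sinh x, Real.cosh_sub_sinh t]

theorem norm_cosh_sq (z : ℂ) :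
    ‖Complex.cosh z‖ ^ 2 = Real.cosh z.re ^ 2 - Real.sin z.im ^ 2 := by
  rw [← Complex.cos_mul_I, norm_cos_sq, Complex.mul_I_re, Complex.mul_I_im, Real.cos_neg,
    Real.cos_sq', Real.sinh_sq]
  ring

theorem norm_cosh_le_cosh (z : ℂ) : ‖Complex.cosh z‖ ≤ Real.cosh z.re := by
  refine le_of_sq_le_sq ?_ (Real.cosh_pos _).le
  rw [norm_cosh_sq]
  linarith [sq_nonneg (Real.sin z.im)]

theorem abs_sin_mul_le {v c : ℝ} (hv0 : 0 ≤ v) (hv : v ≤ π / 2) (hc : 1 ≤ c) :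
    |Real.sin (v * c)| ≤ Real.sin v * (1 + (π / 2 - v) * (π / 2) * (c - 1)) := by
  have hpi := Real.pi_pos
  have hsin0 : 0 ≤ Real.sin v := Real.sin_nonneg_of_nonneg_of_le_pi hv0 (by linarith)
  have hcos0 : 0 ≤ Real.cos v := Real.cos_nonneg_of_neg_pi_div_two_le_of_le (by linarith) hv
  have hstep : 0 ≤ v * (c - 1) := mul_nonneg hv0 (by linarith)
  have hadd : |Real.sin (v * c)| ≤ Real.sin v + Real.cos v * (v * (c - 1)) := by
    rw [show v * c = v + v * (c - 1) by ring, Real.sin_add]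
    refine (abs_add_le _ _).trans ?_
    rw [abs_mul, abs_mul, abs_of_nonneg hsin0, abs_of_nonneg hcos0]
    gcongr
    · exact mul_le_of_le_one_right hsin0 (Real.abs_cos_le_one _)
    · exact Real.abs_sin_le_abs.trans (abs_of_nonneg hstep).le
  have hcos : Real.cos v ≤ π / 2 - v := by
    rw [← Real.sin_pi_div_two_sub]
    exact Real.sin_le (by linarith)
  have hjordan : v ≤ π / 2 * Real.sin v := by
    have := mul_le_mul_of_nonneg_left (Real.mul_le_sin hv0 hv) (by positivity : 0 ≤ π / 2)
    rwa [← mul_assoc, div_mul_div_cancel₀ two_ne_zero, div_self hpi.ne', one_mul] at this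
  calc |Real.sin (v * c)| ≤ Real.sin v + Real.cos v * (v * (c - 1)) := hadd
    _ = Real.sin v + Real.cos v * v * (c - 1) := by ring
    _ ≤ Real.sin v + (π / 2 - v) * (π / 2 * Real.sin v) * (c - 1) := by
      have : 0 ≤ c - 1 := by linarith
      have : 0 ≤ π / 2 - v := by linarith
      gcongr
    _ = Real.sin v * (1 + (π / 2 - v) * (π / 2) * (c - 1)) := by ring

theorem one_add_mul_le_cosh_mul_sinh {v w x : ℝ} (hv0 : 0 ≤ v) (hv : v ≤ π / 2)
    (hvw : v ^ 2 + w ^ 2 = (π / 2) ^ 2) :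
    1 + (π / 2 - v) * (π / 2) * (Real.cosh x - 1) ≤ Real.cosh (w * Real.sinh x) := by
  have hcosh := Real.one_le_cosh x
  have hw : (w * Real.sinh x) ^ 2 / 2 =
      (π / 2 - v) * ((π / 2 + v) * (Real.cosh x + 1) / 2) * (Real.cosh x - 1) := by
    rw [mul_pow, Real.sinh_sq, show w ^ 2 = (π / 2) ^ 2 - v ^ 2 by linarith]
    ring
  have hfactor : π / 2 ≤ (π / 2 + v) * (Real.cosh x + 1) / 2 := by nlinarith [Real.pi_pos]
  calc 1 + (π / 2 - v) * (π / 2) * (Real.cosh x - 1)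
      ≤ 1 + (π / 2 - v) * ((π / 2 + v) * (Real.cosh x + 1) / 2) * (Real.cosh x - 1) := by
        have : 0 ≤ Real.cosh x - 1 := by linarith
        have : 0 ≤ π / 2 - v := by linarith
        gcongr
    _ = 1 + (w * Real.sinh x) ^ 2 / 2 := by rw [hw]
    _ ≤ Real.cosh (w * Real.sinh x) := one_add_sq_div_two_le_cosh _

theorem abs_sin_mul_cosh_le {v w : ℝ} (x : ℝ) (hv : |v| ≤ π / 2)
    (hvw : v ^ 2 + w ^ 2 = (π / 2) ^ 2) :
    |Real.sin (v * Real.cosh x)| ≤ |Real.sin v| * Real.cosh (w * Real.sinh x) := by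
  wlog hv0 : 0 ≤ v generalizing v
  · have := this (v := -v) (by rwa [abs_neg]) (by rwa [neg_sq]) (by linarith)
    rwa [neg_mul, Real.sin_neg, Real.sin_neg, abs_neg, abs_neg] at this
  rw [abs_of_nonneg hv0] at hv
  have hsin0 : 0 ≤ Real.sin v :=
    Real.sin_nonneg_of_nonneg_of_le_pi hv0 (by linarith [Real.pi_pos])
  rw [abs_of_nonneg hsin0]
  exact (abs_sin_mul_le hv0 hv (Real.one_le_cosh x)).trans
    (mul_le_mul_of_nonneg_left (one_add_mul_le_cosh_mul_sinh hv0 hv hvw) hsin0)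

end HyperbolicInequalities

section Transformation

theorem pi_div_two_mul_sinh_eq (ζ : ℂ) : (π / 2 : ℂ) * Complex.sinh ζ =
    ⟨π / 2 * Real.cos ζ.im * Real.sinh ζ.re, π / 2 * Real.sin ζ.im * Real.cosh ζ.re⟩ := by
  rw [Complex.mk_eq_add_mul_I]
  conv_lhs => rw [← Complex.re_add_im ζ, Complex.sinh_add, Complex.cosh_mul_I, Complex.sinh_mul_I]
  push_cast
  ring

theorem hasDerivAt_psi (ζ : ℂ) : HasDerivAt psi
    (Complex.cosh ((π / 2 : ℂ) * Complex.sinh ζ) * ((π / 2 : ℂ) * Complex.cosh ζ)) ζ :=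
  ((Complex.hasDerivAt_sinh ζ).const_mul (π / 2 : ℂ)).csinh

theorem differentiable_psi : Differentiable ℂ psi := fun ζ =>
  (hasDerivAt_psi ζ).differentiableAt

theorem deriv_psi (ζ : ℂ) : deriv psi ζ =
    Complex.cosh ((π / 2 : ℂ) * Complex.sinh ζ) * ((π / 2 : ℂ) * Complex.cosh ζ) :=
  (hasDerivAt_psi ζ).deriv

theorem norm_E1_psi (ζ : ℂ) (γ : ℝ) :
    ‖E1 (psi ζ) γ‖ = (‖Complex.cosh ((π / 2 : ℂ) * Complex.sinh ζ)‖ ^ (γ + 1))⁻¹ := by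
  have hsq : 1 + psi ζ ^ 2 = Complex.cosh ((π / 2 : ℂ) * Complex.sinh ζ) ^ 2 := by
    rw [psi, Complex.cosh_sq, add_comm]
  rw [E1, norm_div, norm_one, one_div, Complex.norm_cpow_real, hsq, norm_pow,
    ← Real.rpow_natCast, ← Real.rpow_mul (norm_nonneg _), Nat.cast_two,
    mul_div_cancel₀ _ two_ne_zero]

theorem norm_deriv_psi_le (ζ : ℂ) : ‖deriv psi ζ‖ ≤
    ‖Complex.cosh ((π / 2 : ℂ) * Complex.sinh ζ)‖ * (π / 2 * Real.cosh ζ.re) := by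
  have hhalf : ‖(π / 2 : ℂ)‖ = π / 2 := by
    rw [norm_div, Complex.norm_of_nonneg Real.pi_pos.le, Complex.norm_two]
  rw [deriv_psi, norm_mul, norm_mul, hhalf]
  gcongr
  exact norm_cosh_le_cosh ζ

theorem cosh_mul_cos_le_norm_cosh (ζ : ℂ) :
    Real.cosh (π / 2 * Real.cos ζ.im * Real.sinh ζ.re) * Real.cos (π / 2 * Real.sin ζ.im) ≤
      ‖Complex.cosh ((π / 2 : ℂ) * Complex.sinh ζ)‖ := by
  refine le_of_sq_le_sq ?_ (norm_nonneg _)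
  rw [norm_cosh_sq, pi_div_two_mul_sinh_eq]
  have hsin : |π / 2 * Real.sin ζ.im| ≤ π / 2 := by
    rw [abs_mul, abs_of_pos Real.pi_div_two_pos]
    exact mul_le_of_le_one_right Real.pi_div_two_pos.le (Real.abs_sin_le_one _)
  have hsq := pow_le_pow_left₀ (abs_nonneg _) (abs_sin_mul_cosh_le ζ.re
    (w := π / 2 * Real.cos ζ.im) hsin (by rw [mul_pow, mul_pow, Real.sin_sq]; ring)) 2
  rw [sq_abs, mul_pow, sq_abs] at hsq
  rw [mul_pow, Real.cos_sq']
  linarith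

theorem cos_half_pi_mul_sin_pos {d : ℝ} (hd0 : 0 ≤ d) (hd : d < π / 2) :
    0 < Real.cos (π / 2 * Real.sin d) := by
  have := Real.pi_pos
  have hsin0 : 0 ≤ Real.sin d := Real.sin_nonneg_of_nonneg_of_le_pi hd0 (by linarith)
  have hsin1 : Real.sin d < 1 := by
    rw [← Real.sin_pi_div_two]
    exact Real.sin_lt_sin_of_lt_of_le_pi_div_two (by linarith) le_rfl hd
  exact Real.cos_pos_of_mem_Ioo ⟨by nlinarith, by nlinarith⟩

theorem cos_half_pi_mul_sin_le {d y : ℝ} (hd : d ≤ π / 2) (hy : |y| ≤ d) :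
    Real.cos (π / 2 * Real.sin d) ≤ Real.cos (π / 2 * Real.sin y) := by
  have hpi := Real.pi_pos
  have hy0 := abs_nonneg y
  have habs : |π / 2 * Real.sin y| = π / 2 * Real.sin |y| := by
    rw [abs_mul, abs_of_pos Real.pi_div_two_pos,
      Real.abs_sin_eq_sin_abs_of_abs_le_pi (by linarith)]
  rw [← Real.cos_abs (π / 2 * Real.sin y), habs]
  refine Real.cos_le_cos_of_nonneg_of_le_pi ?_ ?_ ?_
  · exact mul_nonneg Real.pi_div_two_pos.le (Real.sin_nonneg_of_nonneg_of_le_pi hy0 (by linarith))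
  · nlinarith [Real.sin_le_one d]
  · gcongr
    exact Real.sin_le_sin_of_le_of_le_pi_div_two (by linarith) hd hy

end Transformation

/-- The majorant `cosh x · exp(-a|sinh x|)` of double-exponential decay. On `x ≥ 0` it is the
derivative of `-exp(-a sinh x) / a`. -/
noncomputable def deMajorant (a x : ℝ) : ℝ := Real.cosh x * Real.exp (-(a * |Real.sinh x|))

/-- The integrand `f(ψ(ζ)) ψ'(ζ)` produced by the double-exponential substitution. -/
noncomputable def deIntegrand (f : ℂ → ℂ) (ζ : ℂ) : ℂ := f (psi ζ) * deriv psi ζ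

/-- The class of integrands for which the double-exponential formula is analysed: `f` is analytic
on `ψ(𝒟_d)` and decays like `E₁(·; α)` on the left half and like `E₁(·; β)` on the right half. -/
structure DecayClass (f : ℂ → ℂ) (d K α β : ℝ) : Prop where
  analyticOnNhd : AnalyticOnNhd ℂ f (psi '' strip d)
  norm_le_left : ∀ z ∈ psi '' stripNeg d, ‖f z‖ ≤ K * ‖E1 z α‖
  norm_le_right : ∀ z ∈ psi '' stripPos d, ‖f z‖ ≤ K * ‖E1 z β‖

section Majorant

variable {a : ℝ}

theorem deMajorant_nonneg (a x : ℝ) : 0 ≤ deMajorant a x :=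
  mul_nonneg (Real.cosh_pos x).le (Real.exp_pos _).le

theorem deMajorant_abs (a x : ℝ) : deMajorant a |x| = deMajorant a x := by
  rw [deMajorant, deMajorant, Real.cosh_abs, ← Real.abs_sinh, abs_abs]

theorem deMajorant_neg (a x : ℝ) : deMajorant a (-x) = deMajorant a x := by
  rw [← deMajorant_abs, abs_neg, deMajorant_abs]

theorem deMajorant_of_nonneg (a : ℝ) {x : ℝ} (hx : 0 ≤ x) :
    deMajorant a x = Real.cosh x * Real.exp (-(a * Real.sinh x)) := by
  rw [deMajorant, abs_of_nonneg (Real.sinh_nonneg_iff.mpr hx)]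

theorem deMajorant_anti {b : ℝ} (hab : a ≤ b) (x : ℝ) : deMajorant b x ≤ deMajorant a x := by
  have := (Real.cosh_pos x).le
  unfold deMajorant
  gcongr

theorem deMajorant_le (ha : 0 < a) (x : ℝ) :
    deMajorant a x ≤ (1 + 2 / a) * Real.exp (-(a / 2 * |x|)) := by
  have hcosh : Real.cosh x ≤ 1 + |Real.sinh x| := by
    have := cosh_le_cosh_add_sinh_sub (abs_nonneg x)
    rwa [Real.cosh_zero, Real.sinh_zero, sub_zero, Real.cosh_abs, ← Real.abs_sinh] at this
  have hexp : 1 + |Real.sinh x| ≤ (1 + 2 / a) * Real.exp (a / 2 * |Real.sinh x|) :=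
    calc 1 + |Real.sinh x| ≤ 1 + |Real.sinh x| + (2 / a + a / 2 * |Real.sinh x|) :=
          le_add_of_nonneg_right (by positivity)
      _ = (1 + 2 / a) * (a / 2 * |Real.sinh x| + 1) := by field_simp; ring
      _ ≤ (1 + 2 / a) * Real.exp (a / 2 * |Real.sinh x|) := by
          gcongr
          exact Real.add_one_le_exp _
  calc deMajorant a x
      ≤ (1 + 2 / a) * Real.exp (a / 2 * |Real.sinh x|) * Real.exp (-(a * |Real.sinh x|)) :=
        mul_le_mul_of_nonneg_right (hcosh.trans hexp) (Real.exp_pos _).le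
    _ = (1 + 2 / a) * Real.exp (-(a / 2 * |Real.sinh x|)) := by
        rw [mul_assoc, ← Real.exp_add]
        ring_nf
    _ ≤ (1 + 2 / a) * Real.exp (-(a / 2 * |x|)) := by
        refine mul_le_mul_of_nonneg_left (Real.exp_le_exp.mpr (neg_le_neg ?_)) (by positivity)
        exact mul_le_mul_of_nonneg_left (abs_le_abs_sinh x) (by positivity)

theorem hasDerivAt_neg_exp_sinh (ha : a ≠ 0) {x : ℝ} (hx : 0 ≤ x) :
    HasDerivAt (fun x => -(1 / a * Real.exp (-(a * Real.sinh x)))) (deMajorant a x) x := by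
  rw [deMajorant_of_nonneg a hx]
  refine ((((Real.hasDerivAt_sinh x).const_mul a).neg).exp.const_mul (1 / a)).neg.congr_deriv ?_
  field_simp
  rfl

theorem tendsto_neg_exp_sinh (ha : 0 < a) :
    Tendsto (fun x => -(1 / a * Real.exp (-(a * Real.sinh x)))) atTop (𝓝 0) := by
  have := (Real.tendsto_exp_neg_atTop_nhds_zero.comp
    (Real.sinhOrderIso.tendsto_atTop.const_mul_atTop ha)).const_mul (1 / a)
  rw [mul_zero] at this
  simpa using this.neg

theorem integral_deMajorant (ha : 0 < a) : ∫ x, deMajorant a x = 2 / a := by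
  have hderiv := fun x (hx : x ∈ Ici (0 : ℝ)) => hasDerivAt_neg_exp_sinh ha.ne' hx
  have hhalf : ∫ x in Ioi 0, deMajorant a x = 1 / a := by
    rw [integral_Ioi_of_hasDerivAt_of_nonneg' hderiv (fun x _ => deMajorant_nonneg a x)
      (tendsto_neg_exp_sinh ha)]
    simp
  have heven := integral_comp_abs (f := deMajorant a)
  simp only [deMajorant_abs] at heven
  rw [heven, hhalf, mul_one_div]

theorem integrable_deMajorant (ha : 0 < a) : Integrable (deMajorant a) :=
  not_imp_comm.mp integral_undef (by rw [integral_deMajorant ha]; positivity)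

theorem tendsto_deMajorant (ha : 0 < a) : Tendsto (deMajorant a) (cocompact ℝ) (𝓝 0) := by
  refine squeeze_zero (deMajorant_nonneg a) (deMajorant_le ha) ?_
  have habs : Tendsto (fun x : ℝ => |x|) (cocompact ℝ) atTop := tendsto_norm_cocompact_atTop
  simpa using (Real.tendsto_exp_neg_atTop_nhds_zero.comp
    (habs.const_mul_atTop (half_pos ha))).const_mul (1 + 2 / a)

theorem summable_deMajorant {h : ℝ} (ha : 0 < a) (hh : 0 < h) :
    Summable fun k : ℤ => deMajorant a (k * h) := by
  have hnat : Summable fun k : ℕ => deMajorant a (k * h) := by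
    have hratio : Real.exp (-(a / 2 * h)) < 1 :=
      Real.exp_lt_one_iff.mpr (neg_lt_zero.mpr (by positivity))
    refine Summable.of_nonneg_of_le (fun k => deMajorant_nonneg _ _) (fun k => ?_)
      ((summable_geometric_of_lt_one (Real.exp_pos _).le hratio).mul_left (1 + 2 / a))
    refine (deMajorant_le ha _).trans_eq ?_
    rw [abs_of_nonneg (by positivity), ← Real.exp_nat_mul]
    ring_nf
  refine Summable.of_nat_of_neg (by simpa using hnat) (hnat.congr fun k => ?_)
  rw [Int.cast_neg, neg_mul, deMajorant_neg, Int.cast_natCast]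

end Majorant

section Decay

theorem cos_half_pi_mul_sin_im_pos {ζ : ℂ} (hζ : |ζ.im| < π / 2) :
    0 < Real.cos (π / 2 * Real.sin ζ.im) :=
  (cos_half_pi_mul_sin_pos (abs_nonneg _) hζ).trans_le (cos_half_pi_mul_sin_le hζ.le le_rfl)

theorem exp_mul_cos_le_norm_cosh {ζ : ℂ} (hζ : |ζ.im| < π / 2) :
    Real.exp (π / 2 * Real.cos ζ.im * |Real.sinh ζ.re|) * Real.cos (π / 2 * Real.sin ζ.im) ≤
      2 * ‖Complex.cosh ((π / 2 : ℂ) * Complex.sinh ζ)‖ := by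
  have hcos : 0 < Real.cos ζ.im := Real.cos_pos_of_mem_Ioo (abs_lt.mp hζ)
  have := (cos_half_pi_mul_sin_im_pos hζ).le
  rw [← abs_of_pos (mul_pos Real.pi_div_two_pos hcos), ← abs_mul]
  calc _ ≤ 2 * Real.cosh (π / 2 * Real.cos ζ.im * Real.sinh ζ.re) *
        Real.cos (π / 2 * Real.sin ζ.im) := by
        gcongr
        exact exp_abs_le_two_mul_cosh _
    _ ≤ _ := by
        rw [mul_assoc]
        exact mul_le_mul_of_nonneg_left (cosh_mul_cos_le_norm_cosh ζ) zero_le_two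

theorem norm_cosh_half_pi_mul_sinh_pos {ζ : ℂ} (hζ : |ζ.im| < π / 2) :
    0 < ‖Complex.cosh ((π / 2 : ℂ) * Complex.sinh ζ)‖ :=
  pos_of_mul_pos_right ((mul_pos (Real.exp_pos _) (cos_half_pi_mul_sin_im_pos hζ)).trans_le
    (exp_mul_cos_le_norm_cosh hζ)) zero_le_two

theorem inv_norm_cosh_rpow_le {γ : ℝ} (hγ : 0 ≤ γ) {ζ : ℂ} (hζ : |ζ.im| < π / 2) :
    (‖Complex.cosh ((π / 2 : ℂ) * Complex.sinh ζ)‖ ^ γ)⁻¹ ≤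
      2 ^ γ / Real.cos (π / 2 * Real.sin ζ.im) ^ γ *
        Real.exp (-(γ * (π / 2 * Real.cos ζ.im) * |Real.sinh ζ.re|)) := by
  have hlow := exp_mul_cos_le_norm_cosh hζ
  have hq := cos_half_pi_mul_sin_im_pos hζ
  have hm := norm_cosh_half_pi_mul_sinh_pos hζ
  generalize ‖Complex.cosh ((π / 2 : ℂ) * Complex.sinh ζ)‖ = m at hlow hm ⊢
  generalize Real.cos (π / 2 * Real.sin ζ.im) = q at hlow hq ⊢
  have := Real.rpow_pos_of_pos hq γ
  calc (m ^ γ)⁻¹ = 2 ^ γ / (2 * m) ^ γ := by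
        rw [Real.mul_rpow zero_le_two hm.le]
        field_simp
    _ ≤ 2 ^ γ / (Real.exp (π / 2 * Real.cos ζ.im * |Real.sinh ζ.re|) * q) ^ γ := by gcongr
    _ = _ := by
        rw [Real.mul_rpow (Real.exp_pos _).le hq.le, ← Real.exp_mul, Real.exp_neg,
          mul_comm _ γ, ← mul_assoc γ]
        field_simp

theorem norm_deIntegrand_le {f : ℂ → ℂ} {K γ : ℝ} (hK : 0 ≤ K) (hγ : 0 ≤ γ) {ζ : ℂ}
    (hζ : |ζ.im| < π / 2) (hf : ‖f (psi ζ)‖ ≤ K * ‖E1 (psi ζ) γ‖) :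
    ‖deIntegrand f ζ‖ ≤ K * (π / 2) * (2 ^ γ / Real.cos (π / 2 * Real.sin ζ.im) ^ γ) *
      deMajorant (γ * (π / 2 * Real.cos ζ.im)) ζ.re := by
  have hpow := inv_norm_cosh_rpow_le hγ hζ
  have hderiv := norm_deriv_psi_le ζ
  have hcosh := (Real.cosh_pos ζ.re).le
  have hm := norm_cosh_half_pi_mul_sinh_pos hζ
  rw [norm_E1_psi] at hf
  generalize ‖Complex.cosh ((π / 2 : ℂ) * Complex.sinh ζ)‖ = m at hpow hf hderiv hm
  rw [deIntegrand, norm_mul]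
  calc ‖f (psi ζ)‖ * ‖deriv psi ζ‖
      ≤ K * (m ^ (γ + 1))⁻¹ * (m * (π / 2 * Real.cosh ζ.re)) :=
        mul_le_mul hf hderiv (norm_nonneg _) (by positivity)
    _ = K * (π / 2) * Real.cosh ζ.re * (m ^ γ)⁻¹ := by
        rw [Real.rpow_add hm, Real.rpow_one]
        field_simp
    _ ≤ K * (π / 2) * Real.cosh ζ.re * (2 ^ γ / Real.cos (π / 2 * Real.sin ζ.im) ^ γ *
          Real.exp (-(γ * (π / 2 * Real.cos ζ.im) * |Real.sinh ζ.re|))) := by gcongr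
    _ = _ := by
        rw [deMajorant]
        ring

theorem norm_deIntegrand_le_of_mem_strip {f : ℂ → ℂ} {K d γ μ ν : ℝ} (hK : 0 ≤ K) (hμ : 0 ≤ μ)
    (hμγ : μ ≤ γ) (hγν : γ ≤ ν) (hd : d < π / 2) {ζ : ℂ} (hζ : ζ ∈ strip d)
    (hf : ‖f (psi ζ)‖ ≤ K * ‖E1 (psi ζ) γ‖) :
    ‖deIntegrand f ζ‖ ≤ K * (π / 2) * (2 ^ ν / Real.cos (π / 2 * Real.sin d) ^ ν) *
      deMajorant (μ * (π / 2 * Real.cos d)) ζ.re := by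
  have hζd : |ζ.im| < d := hζ
  have hγ0 : 0 ≤ γ := hμ.trans hμγ
  have hqd : 0 < Real.cos (π / 2 * Real.sin d) :=
    cos_half_pi_mul_sin_pos ((abs_nonneg _).trans hζd.le) hd
  have hq := cos_half_pi_mul_sin_le hd.le hζd.le
  have hcos : Real.cos d ≤ Real.cos ζ.im := by
    rw [← Real.cos_abs ζ.im]
    exact Real.cos_le_cos_of_nonneg_of_le_pi (abs_nonneg _) (by linarith [Real.pi_pos]) hζd.le
  have hrate : μ * (π / 2 * Real.cos d) ≤ γ * (π / 2 * Real.cos ζ.im) := by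
    have := Real.cos_nonneg_of_mem_Icc ⟨by linarith [Real.pi_pos, abs_nonneg ζ.im], hd.le⟩
    gcongr
  have hpow : Real.cos (π / 2 * Real.sin d) ^ ν ≤ Real.cos (π / 2 * Real.sin ζ.im) ^ γ :=
    (Real.rpow_le_rpow_of_exponent_ge hqd (Real.cos_le_one _) hγν).trans
      (Real.rpow_le_rpow hqd.le hq hγ0)
  have := Real.rpow_pos_of_pos hqd ν
  refine (norm_deIntegrand_le hK hγ0 (hζd.trans hd) hf).trans ?_
  gcongr
  · exact deMajorant_nonneg _ _
  · exact one_le_two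
  · exact deMajorant_anti hrate _

end Decay

namespace DecayClass

variable {f : ℂ → ℂ} {d K α β : ℝ}

theorem norm_comp_psi_le_left (hf : DecayClass f d K α β) {ζ : ℂ} (hζ : ζ ∈ strip d)
    (hre : ζ.re < 0) : ‖f (psi ζ)‖ ≤ K * ‖E1 (psi ζ) α‖ :=
  hf.norm_le_left _ (mem_image_of_mem _ ⟨hζ, hre⟩)

theorem norm_comp_psi_le_right (hf : DecayClass f d K α β) {ζ : ℂ} (hζ : ζ ∈ strip d)
    (hre : 0 ≤ ζ.re) : ‖f (psi ζ)‖ ≤ K * ‖E1 (psi ζ) β‖ :=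
  hf.norm_le_right _ (mem_image_of_mem _ ⟨hζ, hre⟩)

theorem differentiableOn_deIntegrand (hf : DecayClass f d K α β) :
    DifferentiableOn ℂ (deIntegrand f) (strip d) := by
  have hcomp : DifferentiableOn ℂ (f ∘ psi) (strip d) :=
    hf.analyticOnNhd.differentiableOn.comp differentiable_psi.differentiableOn
      (mapsTo_image psi (strip d))
  have hderiv : Differentiable ℂ (deriv psi) := by
    simp only [funext deriv_psi]
    fun_prop
  exact hcomp.mul hderiv.differentiableOn

theorem dominatedOn_deIntegrand (hf : DecayClass f d K α β) (hK : 0 ≤ K) (hα : 0 < α)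
    (hβ : 0 < β) (hd0 : 0 < d) (hd : d < π / 2) :
    DominatedOn (deIntegrand f)
      (fun x => K * (π / 2) * (2 ^ max α β / Real.cos (π / 2 * Real.sin d) ^ max α β) *
        deMajorant (min α β * (π / 2 * Real.cos d)) x) (strip d) := by
  have hμ : 0 < min α β := lt_min hα hβ
  have hcos : 0 < Real.cos d := Real.cos_pos_of_mem_Ioo ⟨by linarith, hd⟩
  have ha : 0 < min α β * (π / 2 * Real.cos d) := by positivity
  refine ⟨hf.differentiableOn_deIntegrand, fun ζ hζ => ?_,
    (integrable_deMajorant ha).const_mul _, ?_⟩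
  · rcases lt_or_ge ζ.re 0 with hre | hre
    · exact norm_deIntegrand_le_of_mem_strip hK hμ.le (min_le_left α β) (le_max_left α β) hd hζ
        (hf.norm_comp_psi_le_left hζ hre)
    · exact norm_deIntegrand_le_of_mem_strip hK hμ.le (min_le_right α β) (le_max_right α β) hd hζ
        (hf.norm_comp_psi_le_right hζ hre)
  · simpa only [mul_zero] using (tendsto_deMajorant ha).const_mul _

theorem integrable_deIntegrand_ofReal (hf : DecayClass f d K α β) (hK : 0 ≤ K) (hα : 0 < α)
    (hβ : 0 < β) (hd0 : 0 < d) (hd : d < π / 2) : Integrable fun x : ℝ => deIntegrand f x :=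
  ((hf.dominatedOn_deIntegrand hK hα hβ hd0 hd).mono
    (closedStrip_subset_strip hd0)).integrable_ofReal le_rfl

theorem summable_norm_deIntegrand (hf : DecayClass f d K α β) (hK : 0 ≤ K) (hα : 0 < α)
    (hβ : 0 < β) (hd0 : 0 < d) (hd : d < π / 2) {h : ℝ} (hh : 0 < h) :
    Summable fun k : ℤ => ‖deIntegrand f ((k * h : ℝ) : ℂ)‖ := by
  have hcos : 0 < Real.cos d := Real.cos_pos_of_mem_Ioo ⟨by linarith, hd⟩
  have hrate : 0 < min α β * (π / 2 * Real.cos d) :=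
    mul_pos (lt_min hα hβ) (mul_pos Real.pi_div_two_pos hcos)
  exact Summable.of_nonneg_of_le (fun _ => norm_nonneg _)
    (fun k => ((hf.dominatedOn_deIntegrand hK hα hβ hd0 hd).mono
      (closedStrip_subset_strip hd0)).norm_ofReal_le le_rfl (k * h))
    ((summable_deMajorant hrate hh).mul_left _)

theorem norm_integral_Iic_sub_tsum_le (hf : DecayClass f d K α β) (hK : 0 ≤ K) (hα : 0 < α)
    (hβ : 0 < β) (hd0 : 0 < d) (hd : d < π / 2) {h : ℝ} (hh : 0 < h) (ξ : ℝ) :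
    ‖(∫ x in Iic ξ, deIntegrand f (x : ℂ)) -
        ∑' k : ℤ, deIntegrand f ((k * h : ℝ) : ℂ) * (J k h ξ : ℂ)‖ ≤
      2 ^ (max α β + 1) * K / (min α β * d) *
        (1 / (Real.cos (π / 2 * Real.sin d) ^ max α β * Real.cos d)) *
          (h / (π * Real.sinh (π * d / h))) := by
  have : 0 < min α β := lt_min hα hβ
  have hcos : 0 < Real.cos d := Real.cos_pos_of_mem_Ioo ⟨by linarith, hd⟩
  have hbound := norm_integral_Iic_sub_tsum_J_le_of_strip hh hd0
    (hf.dominatedOn_deIntegrand hK hα hβ hd0 hd)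
    (hf.summable_norm_deIntegrand hK hα hβ hd0 hd hh).of_norm ξ
  rw [integral_const_mul, integral_deMajorant (by positivity)] at hbound
  refine hbound.trans_eq ?_
  rw [Real.rpow_add two_pos, Real.rpow_one]
  field_simp

end DecayClass

section Truncation

theorem sum_Icc_sub_add_natCast (c : ℤ → ℂ) {M N : ℤ} (hMN : -M ≤ N + 1) (n : ℕ) :
    ∑ k ∈ Finset.Icc (-M - n) (N + n), c k = ∑ k ∈ Finset.Icc (-M) N, c k +
      (∑ j ∈ Finset.range n, c (-(M + 1 + j)) + ∑ j ∈ Finset.range n, c (N + 1 + j)) := by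
  induction n with
  | zero => simp
  | succ n ih =>
    have hIcc : Finset.Icc (-M - ((n + 1 : ℕ) : ℤ)) (N + ((n + 1 : ℕ) : ℤ)) =
        insert (N + 1 + (n : ℤ)) (insert (-(M + 1 + (n : ℤ))) (Finset.Icc (-M - n) (N + n))) := by
      ext x
      simp only [Finset.mem_Icc, Finset.mem_insert]
      lia
    rw [hIcc, Finset.sum_insert, Finset.sum_insert, ih, Finset.sum_range_succ,
      Finset.sum_range_succ]
    · ring
    · simp only [Finset.mem_Icc]
      lia
    · simp only [Finset.mem_Icc, Finset.mem_insert]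
      lia

theorem norm_tsum_sub_sum_Icc_le {c : ℤ → ℂ} (hc : Summable c) {M N : ℤ} (hMN : -M ≤ N + 1)
    {S T : ℝ} (hS : ∀ n : ℕ, ∑ j ∈ Finset.range n, ‖c (-(M + 1 + j))‖ ≤ S)
    (hT : ∀ n : ℕ, ∑ j ∈ Finset.range n, ‖c (N + 1 + j)‖ ≤ T) :
    ‖∑' k, c k - ∑ k ∈ Finset.Icc (-M) N, c k‖ ≤ S + T := by
  have hexhaust : Tendsto (fun n : ℕ => Finset.Icc (-M - n) (N + n)) atTop atTop := by
    refine Monotone.tendsto_atTop_finset (fun m n hmn => ?_)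
      fun k => ⟨k.natAbs + M.natAbs + N.natAbs, ?_⟩
    · exact Finset.Icc_subset_Icc (by lia) (by lia)
    · rw [Finset.mem_Icc]
      lia
  refine le_of_tendsto'
    ((hc.hasSum.comp hexhaust).sub_const (∑ k ∈ Finset.Icc (-M) N, c k)).norm fun n => ?_
  rw [Function.comp_apply, sum_Icc_sub_add_natCast c hMN, add_sub_cancel_left]
  exact (norm_add_le _ _).trans
    (add_le_add ((norm_sum_le _ _).trans (hS n)) ((norm_sum_le _ _).trans (hT n)))

variable {a x h : ℝ}

theorem deMajorant_le_two_mul {t : ℝ} (hx : 0 ≤ x) (hxt : x ≤ t)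
    (hc : 1 ≤ 2 * a * Real.cosh x) : deMajorant a t ≤ 2 * deMajorant a x := by
  have hsinh : 0 ≤ Real.sinh t - Real.sinh x := sub_nonneg.mpr (Real.sinh_le_sinh.mpr hxt)
  have hgrowth : Real.cosh t ≤ 2 * Real.cosh x * Real.exp (a * (Real.sinh t - Real.sinh x)) :=
    calc Real.cosh t ≤ Real.cosh x + 1 * (Real.sinh t - Real.sinh x) := by
          rw [one_mul]
          exact cosh_le_cosh_add_sinh_sub hxt
      _ ≤ 2 * Real.cosh x + 2 * a * Real.cosh x * (Real.sinh t - Real.sinh x) := by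
          gcongr
          linarith [Real.cosh_pos x]
      _ = 2 * Real.cosh x * (a * (Real.sinh t - Real.sinh x) + 1) := by ring
      _ ≤ _ := by
          gcongr
          exact Real.add_one_le_exp _
  rw [deMajorant_of_nonneg a hx, deMajorant_of_nonneg a (hx.trans hxt)]
  calc Real.cosh t * Real.exp (-(a * Real.sinh t))
      ≤ 2 * Real.cosh x * Real.exp (a * (Real.sinh t - Real.sinh x)) *
          Real.exp (-(a * Real.sinh t)) :=
        mul_le_mul_of_nonneg_right hgrowth (Real.exp_pos _).le
    _ = 2 * (Real.cosh x * Real.exp (-(a * Real.sinh x))) := by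
        rw [mul_assoc, ← Real.exp_add]
        ring_nf

theorem one_le_two_mul_cosh_mono {t : ℝ} (ha : 0 < a) (hx : 0 ≤ x) (hxt : x ≤ t)
    (hc : 1 ≤ 2 * a * Real.cosh x) : 1 ≤ 2 * a * Real.cosh t := by
  refine hc.trans (mul_le_mul_of_nonneg_left ?_ (by positivity))
  rwa [Real.cosh_le_cosh, abs_of_nonneg hx, abs_of_nonneg (hx.trans hxt)]

theorem mul_deMajorant_add_le (ha : 0 < a) (hx : 0 ≤ x) (hh : 0 < h)
    (hc : 1 ≤ 2 * a * Real.cosh x) :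
    h * deMajorant a (x + h) ≤
      2 / a * Real.exp (-(a * Real.sinh x)) - 2 / a * Real.exp (-(a * Real.sinh (x + h))) := by
  have hderiv := fun y (hy : x ≤ y) => hasDerivAt_neg_exp_sinh ha.ne' (hx.trans hy)
  obtain ⟨t, ht, hslope⟩ := exists_hasDerivAt_eq_slope _ _ (lt_add_of_pos_right x hh)
    (fun y hy => (hderiv y hy.1).continuousAt.continuousWithinAt) fun y hy => hderiv y hy.1.le
  rw [add_sub_cancel_left, eq_div_iff hh.ne'] at hslope
  have ht0 : 0 ≤ t := hx.trans ht.1.le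
  have hdouble := deMajorant_le_two_mul ht0 ht.2.le
    (one_le_two_mul_cosh_mono ha hx ht.1.le hc)
  calc h * deMajorant a (x + h) ≤ h * (2 * deMajorant a t) := by gcongr
    _ = 2 * (deMajorant a t * h) := by ring
    _ = _ := by
        rw [hslope]
        ring

theorem sum_deMajorant_le (ha : 0 < a) (hx : 0 ≤ x) (hh : 0 < h)
    (hc : 1 ≤ 2 * a * Real.cosh x) (n : ℕ) :
    ∑ j ∈ Finset.range n, h * deMajorant a (x + (j + 1) * h) ≤
      2 / a * Real.exp (-(a * Real.sinh x)) := by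
  have hstep : ∀ j : ℕ, h * deMajorant a (x + (j + 1) * h) ≤
      2 / a * Real.exp (-(a * Real.sinh (x + j * h))) -
        2 / a * Real.exp (-(a * Real.sinh (x + (j + 1 : ℕ) * h))) := fun j => by
    have hxj : x ≤ x + j * h := le_add_of_nonneg_right (by positivity)
    have hadd : x + (j + 1) * h = x + j * h + h := by ring
    rw [Nat.cast_succ, hadd]
    exact mul_deMajorant_add_le ha (hx.trans hxj) hh (one_le_two_mul_cosh_mono ha hx hxj hc)
  refine (Finset.sum_le_sum fun j _ => hstep j).trans ?_
  rw [Finset.sum_range_sub', Nat.cast_zero, zero_mul, add_zero]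
  exact sub_le_self _ (by positivity)

theorem xThreshold_pos {γ : ℝ} (hγ : 0 < γ) : 0 < xThreshold γ := by
  unfold xThreshold
  split_ifs <;> rw [Real.arsinh_pos_iff] <;> positivity

theorem one_le_two_mul_cosh_of_xThreshold_le {γ : ℝ} (hγ : 0 < γ)
    (hx : xThreshold (γ / 2) ≤ x) : 1 ≤ 2 * (γ * (π / 2)) * Real.cosh x := by
  have hcosh := Real.one_le_cosh x
  rw [show 2 * (γ * (π / 2)) = 2 * π * (γ / 2) by ring]
  unfold xThreshold at hx
  split_ifs at hx with hlt
  · have hsinh := Real.sinh_le_sinh.mpr hx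
    rw [Real.sinh_arsinh, div_le_iff₀' (by positivity)] at hsinh
    have hsqrt : 1 ≤ √(1 + √(1 - (2 * π * (γ / 2)) ^ 2)) :=
      Real.one_le_sqrt.mpr (le_add_of_nonneg_right (Real.sqrt_nonneg _))
    exact (hsqrt.trans hsinh).trans
      (mul_le_mul_of_nonneg_left (Real.sinh_lt_cosh x).le (by positivity))
  · rw [not_lt, div_le_iff₀' (by positivity)] at hlt
    exact one_le_mul_of_one_le_of_one_le hlt hcosh

theorem norm_deIntegrand_mul_J_le {f : ℂ → ℂ} {K γ : ℝ} (hK : 0 ≤ K) (hγ : 0 ≤ γ) (hh : 0 < h)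
    (k : ℤ) (ξ : ℝ) (hf : ‖f (psi x)‖ ≤ K * ‖E1 (psi x) γ‖) :
    ‖deIntegrand f x * (J k h ξ : ℂ)‖ ≤
      K * (π / 2) * 2 ^ γ * (3 / 2) * (h * deMajorant (γ * (π / 2)) x) := by
  have hF := norm_deIntegrand_le hK hγ (ζ := x) (by simp [Real.pi_pos]) hf
  simp only [Complex.ofReal_re, Complex.ofReal_im, Real.cos_zero, Real.sin_zero, mul_zero,
    Real.one_rpow, div_one, mul_one] at hF
  rw [norm_mul, Complex.norm_real]
  refine (mul_le_mul hF (abs_J_le k hh ξ) (abs_nonneg _) ((norm_nonneg _).trans hF)).trans_eq ?_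
  ring

theorem sum_norm_tail_le {c : ℕ → ℂ} {K γ : ℝ} (hK : 0 ≤ K) (hγ : 0 < γ) (hh : 0 < h)
    (hx : xThreshold (γ / 2) ≤ x)
    (hc : ∀ j : ℕ, ‖c j‖ ≤ K * (π / 2) * 2 ^ γ * (3 / 2) *
      (h * deMajorant (γ * (π / 2)) (x + (j + 1) * h))) (n : ℕ) :
    ∑ j ∈ Finset.range n, ‖c j‖ ≤
      3 * K * (2 ^ γ / γ) * Real.exp (-(γ * (π / 2) * Real.sinh x)) :=
  calc ∑ j ∈ Finset.range n, ‖c j‖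
      ≤ K * (π / 2) * 2 ^ γ * (3 / 2) *
          ∑ j ∈ Finset.range n, h * deMajorant (γ * (π / 2)) (x + (j + 1) * h) := by
        rw [Finset.mul_sum]
        exact Finset.sum_le_sum fun j _ => hc j
    _ ≤ K * (π / 2) * 2 ^ γ * (3 / 2) * (2 / (γ * (π / 2)) *
          Real.exp (-(γ * (π / 2) * Real.sinh x))) := by
        gcongr
        exact sum_deMajorant_le (by positivity)
          ((xThreshold_pos (half_pos hγ)).le.trans hx) hh
          (one_le_two_mul_cosh_of_xThreshold_le hγ hx) n
    _ = _ := by field_simp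

theorem DecayClass.norm_tsum_sub_sum_le {f : ℂ → ℂ} {d K α β : ℝ} (hf : DecayClass f d K α β)
    (hK : 0 ≤ K) (hα : 0 < α) (hβ : 0 < β) (hd0 : 0 < d) (hd : d < π / 2) (hh : 0 < h) {M N : ℤ}
    (hM : xThreshold (α / 2) ≤ M * h) (hN : xThreshold (β / 2) ≤ N * h) (ξ : ℝ) :
    ‖∑' k : ℤ, deIntegrand f ((k * h : ℝ) : ℂ) * (J k h ξ : ℂ) -
        ∑ k ∈ Finset.Icc (-M) N, deIntegrand f ((k * h : ℝ) : ℂ) * (J k h ξ : ℂ)‖ ≤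
      3 * K * (2 ^ α / α) * Real.exp (-(α * (π / 2) * Real.sinh (M * h))) +
        3 * K * (2 ^ β / β) * Real.exp (-(β * (π / 2) * Real.sinh (N * h))) := by
  have hM0 : 0 < M * h := (xThreshold_pos (half_pos hα)).trans_le hM
  have hN0 : 0 < N * h := (xThreshold_pos (half_pos hβ)).trans_le hN
  have hMN : -M ≤ N + 1 := by
    have : (0 : ℝ) < M := pos_of_mul_pos_left hM0 hh.le
    have : (0 : ℝ) < N := pos_of_mul_pos_left hN0 hh.le
    exact_mod_cast (by linarith : (-M : ℝ) ≤ N + 1)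
  have hsummable : Summable fun k : ℤ => deIntegrand f ((k * h : ℝ) : ℂ) * (J k h ξ : ℂ) := by
    refine .of_norm_bounded
      ((hf.summable_norm_deIntegrand hK hα hβ hd0 hd hh).mul_right (3 / 2 * h)) fun k => ?_
    rw [norm_mul, Complex.norm_real]
    exact mul_le_mul_of_nonneg_left (abs_J_le k hh ξ) (norm_nonneg _)
  refine norm_tsum_sub_sum_Icc_le hsummable hMN
    (sum_norm_tail_le hK hα hh hM fun j => ?_) (sum_norm_tail_le hK hβ hh hN fun j => ?_)
  · have hnode : ((-(M + 1 + j) : ℤ) : ℝ) * h = -(M * h + (j + 1) * h) := by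
      push_cast
      ring
    have hpos : 0 < M * h + (j + 1) * h := by positivity
    rw [hnode, ← deMajorant_neg]
    exact norm_deIntegrand_mul_J_le hK hα.le hh _ ξ
      (hf.norm_comp_psi_le_left (ofReal_mem_strip hd0 _) (neg_lt_zero.mpr hpos))
  · have hnode : ((N + 1 + j : ℤ) : ℝ) * h = N * h + (j + 1) * h := by
      push_cast
      ring
    have hpos : 0 ≤ N * h + (j + 1) * h := by positivity
    rw [hnode]
    exact norm_deIntegrand_mul_J_le hK hβ.le hh _ ξ
      (hf.norm_comp_psi_le_right (ofReal_mem_strip hd0 _) hpos)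

end Truncation

section ChangeOfVariables

/-- The restriction of `ψ` to the real axis, as a real function. -/
noncomputable def psiReal (x : ℝ) : ℝ := Real.sinh (π / 2 * Real.sinh x)

theorem psi_ofReal (x : ℝ) : psi x = (psiReal x : ℂ) := by
  simp [psi, psiReal]

theorem psiReal_psiInv (τ : ℝ) : psiReal (psiInv τ) = τ := by
  exact_mod_cast (psi_ofReal _).symm.trans (psi_psiInv τ)

theorem strictMono_psiReal : StrictMono psiReal :=
  Real.sinh_strictMono.comp (Real.sinh_strictMono.const_mul Real.pi_div_two_pos)

theorem hasDerivAt_psiReal (x : ℝ) :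
    HasDerivAt psiReal (Real.cosh (π / 2 * Real.sinh x) * (π / 2 * Real.cosh x)) x :=
  ((Real.hasDerivAt_sinh x).const_mul (π / 2)).sinh

theorem abs_deriv_psiReal_smul (f : ℂ → ℂ) (x : ℝ) :
    |Real.cosh (π / 2 * Real.sinh x) * (π / 2 * Real.cosh x)| • f (psiReal x) =
      deIntegrand f x := by
  have := Real.cosh_pos x
  rw [abs_of_pos (mul_pos (Real.cosh_pos _) (by positivity)), deIntegrand, psi_ofReal, deriv_psi,
    Complex.real_smul, mul_comm]
  push_cast
  rfl

theorem psiReal_image_univ : psiReal '' univ = univ :=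
  image_univ_of_surjective fun τ => ⟨_, psiReal_psiInv τ⟩

theorem psiReal_image_Iic (τ : ℝ) : psiReal '' Iic (psiInv τ) = Iic τ := by
  ext t
  constructor
  · rintro ⟨x, hx, rfl⟩
    rw [mem_Iic, ← psiReal_psiInv τ]
    exact strictMono_psiReal.monotone hx
  · refine fun ht => ⟨psiInv t, ?_, psiReal_psiInv t⟩
    rwa [mem_Iic, ← strictMono_psiReal.le_iff_le, psiReal_psiInv, psiReal_psiInv]

theorem integrable_iff_integrable_deIntegrand (f : ℂ → ℂ) :
    Integrable (fun t : ℝ => f t) ↔ Integrable fun x : ℝ => deIntegrand f x := by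
  have := integrableOn_image_iff_integrableOn_abs_deriv_smul MeasurableSet.univ
    (fun x _ => (hasDerivAt_psiReal x).hasDerivWithinAt) strictMono_psiReal.injective.injOn
    fun t : ℝ => f t
  simpa only [psiReal_image_univ, integrableOn_univ, abs_deriv_psiReal_smul] using this

theorem integral_Iic_eq_integral_Iic_deIntegrand (f : ℂ → ℂ) (τ : ℝ) :
    ∫ t in Iic τ, f (t : ℂ) = ∫ x in Iic (psiInv τ), deIntegrand f x := by
  have := integral_image_eq_integral_abs_deriv_smul measurableSet_Iic
    (fun x _ => (hasDerivAt_psiReal x).hasDerivWithinAt) strictMono_psiReal.injective.injOn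
    (s := Iic (psiInv τ)) fun t : ℝ => f t
  simpa only [psiReal_image_Iic, abs_deriv_psiReal_smul] using this

end ChangeOfVariables

section Parameters

theorem exp_neg_one_le_one_sub_inv_add_exp_neg {L : ℝ} (hL : 1 ≤ L) :
    Real.exp (-1) ≤ 1 - 1 / L + Real.exp (-L) := by
  have hinv : 1 / L ≤ 1 := by
    rw [one_div]
    exact inv_le_one_of_one_le₀ hL
  have hhalf : Real.exp (-1) ≤ 1 / 2 := by
    rw [Real.exp_neg, one_div]
    exact inv_anti₀ two_pos (by linarith [Real.add_one_le_exp (1 : ℝ)])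
  have hfactor : 1 - Real.exp (1 - L) ≤ 2 * (1 - 1 / L) := by
    rcases le_total L 2 with hL2 | hL2
    · have hnonneg : 0 ≤ (L - 1) * (2 - L) / L :=
        div_nonneg (mul_nonneg (by linarith) (by linarith)) (by linarith)
      have hdiff : (L - 1) * (2 - L) / L = 2 * (1 - 1 / L) - (L - 1) := by
        field_simp
      linarith [Real.add_one_le_exp (1 - L)]
    · linarith [Real.exp_pos (1 - L), one_div_le_one_div_of_le two_pos hL2]
  have hsplit : Real.exp (-L) = Real.exp (-1) * Real.exp (1 - L) := by
    rw [← Real.exp_add]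
    ring_nf
  calc Real.exp (-1) = Real.exp (-1) * (1 - Real.exp (1 - L)) + Real.exp (-L) := by
        rw [hsplit]
        ring
    _ ≤ Real.exp (-1) * (2 * (1 - 1 / L)) + Real.exp (-L) := by gcongr
    _ ≤ 1 / 2 * (2 * (1 - 1 / L)) + Real.exp (-L) := by gcongr
    _ = 1 - 1 / L + Real.exp (-L) := by ring

theorem two_mul_sub_half_le_mul_sinh {γ y X : ℝ} (hγ : 0 ≤ γ) (hX : 0 ≤ X)
    (hy : 4 * y ≤ γ * Real.exp X) : 2 * y - γ / 2 ≤ γ * Real.sinh X := by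
  have := mul_le_mul_of_nonneg_left (Real.exp_le_one_iff.mpr (neg_nonpos.mpr hX)) hγ
  rw [Real.sinh_eq]
  linarith

theorem three_mul_mul_exp_neg_le_one {y : ℝ} (hy : 0 ≤ y) :
    3 * y * Real.exp (-(π * y * Real.exp (-1))) ≤ 1 := by
  have hmax := Real.mul_exp_neg_le_exp_neg_one (π * y * Real.exp (-1))
  calc 3 * y * Real.exp (-(π * y * Real.exp (-1)))
      ≤ π * y * Real.exp (-(π * y * Real.exp (-1))) := by
        gcongr
        exact Real.pi_gt_three.le
    _ ≤ 1 := by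
        refine le_of_mul_le_mul_right ?_ (Real.exp_pos (-1))
        linarith

theorem inv_sinh_le {b x : ℝ} (hb : 0 < b) (hbx : b ≤ x) :
    (Real.sinh x)⁻¹ ≤ 2 * Real.exp (-x) / (1 - Real.exp (-(2 * b))) := by
  have hpos : 0 < 1 - Real.exp (-(2 * b)) := by
    rw [sub_pos, Real.exp_lt_one_iff]
    linarith
  have hone : Real.exp x * Real.exp (-x) = 1 := by
    rw [← Real.exp_add, add_neg_cancel, Real.exp_zero]
  have hsinh : Real.sinh x = (1 - Real.exp (-(2 * x))) / (2 * Real.exp (-x)) := by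
    rw [Real.sinh_eq, eq_div_iff (by positivity), show -(2 * x) = -x + -x by ring, Real.exp_add]
    linear_combination hone
  rw [hsinh, inv_div]
  gcongr

variable {d h n μ γ δ : ℝ}

theorem mul_exp_one_mul_le (hn : 0 < n) (hμ : 0 ≤ μ) (hmesh : 4 * d * n = μ * Real.exp (n * h)) :
    μ * Real.exp 1 * h ≤ 4 * d := by
  refine le_of_mul_le_mul_right ?_ hn
  calc μ * Real.exp 1 * h * n = μ * (Real.exp 1 * (n * h)) := by ring
    _ ≤ μ * Real.exp (n * h) := by
        gcongr
        exact Real.exp_one_mul_le_exp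
    _ = 4 * d * n := hmesh.symm

theorem div_pi_mul_sinh_le (hn : 0 < n) (hh : 0 < h) (hμ : 0 < μ)
    (hmesh : 4 * d * n = μ * Real.exp (n * h)) :
    h / (π * Real.sinh (π * d / h)) ≤
      1 / (1 - Real.exp (-(π * μ * Real.exp 1 / 2))) * (Real.exp (-(π * d / h)) * h) := by
  have hle : π * μ * Real.exp 1 / 4 ≤ π * d / h := by
    rw [le_div_iff₀ hh]
    linarith [mul_le_mul_of_nonneg_left (mul_exp_one_mul_le hn hμ.le hmesh) Real.pi_pos.le]
  have hinv := inv_sinh_le (by positivity) hle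
  have hdouble : 2 * (π * μ * Real.exp 1 / 4) = π * μ * Real.exp 1 / 2 := by ring
  rw [hdouble] at hinv
  have hpi : 2 / π ≤ 1 := (div_le_one Real.pi_pos).mpr Real.two_le_pi
  have hnonneg : 0 ≤ 1 - Real.exp (-(π * μ * Real.exp 1 / 2)) := by
    rw [sub_nonneg, Real.exp_le_one_iff, neg_nonpos]
    positivity
  calc h / (π * Real.sinh (π * d / h)) = h / π * (Real.sinh (π * d / h))⁻¹ := by
        rw [div_mul_eq_div_div, div_eq_mul_inv (h / π)]
    _ ≤ h / π * (2 * Real.exp (-(π * d / h)) / (1 - Real.exp (-(π * μ * Real.exp 1 / 2)))) := by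
        gcongr
    _ = 2 / π * (1 / (1 - Real.exp (-(π * μ * Real.exp 1 / 2))) *
          (Real.exp (-(π * d / h)) * h)) := by ring
    _ ≤ _ := mul_le_of_le_one_left (by positivity) hpi

theorem neg_mul_sinh_le {X : ℝ} (hd : 0 < d) (hn : 0 < n) (hh : 1 ≤ n * h)
    (hmesh : 4 * d * n = μ * Real.exp (n * h)) (hγ : 0 ≤ γ) (hX : 0 ≤ X)
    (hγX : 4 * d * n ≤ γ * Real.exp X) (hμδ : μ ≤ δ) :
    -(γ * (π / 2) * Real.sinh X) ≤
      -(π * (d * n) * Real.exp (-1)) + (π * (γ + δ) / 4 + -(π * d / h)) := by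
  have hsinh := mul_le_mul_of_nonneg_left (two_mul_sub_half_le_mul_sinh hγ hX
    (by rwa [← mul_assoc] : 4 * (d * n) ≤ _)) Real.pi_div_two_pos.le
  have hexp := mul_le_mul_of_nonneg_left (exp_neg_one_le_one_sub_inv_add_exp_neg hh)
    (by positivity : 0 ≤ π * (d * n))
  have hμ : π * (d * n) * Real.exp (-(n * h)) = π / 4 * μ := by
    rw [Real.exp_neg, ← div_eq_mul_inv, div_eq_iff (Real.exp_pos _).ne']
    linear_combination π / 4 * hmesh
  have hinv : π * (d * n) * (1 / (n * h)) = π * d / h := by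
    field_simp
  have hδ := mul_le_mul_of_nonneg_left hμδ (by positivity : 0 ≤ π / 4)
  rw [mul_add, mul_sub, mul_one, hinv, hμ] at hexp
  linarith

theorem three_mul_exp_neg_mul_sinh_le {X : ℝ} (hd : 0 < d) (hn : 0 < n) (hh : 1 ≤ n * h)
    (hmesh : 4 * d * n = μ * Real.exp (n * h)) (hγ : 0 ≤ γ) (hX : 0 ≤ X)
    (hγX : 4 * d * n ≤ γ * Real.exp X) (hμδ : μ ≤ δ) :
    3 * Real.exp (-(γ * (π / 2) * Real.sinh X)) ≤
      1 / d * (Real.exp (π * (γ + δ) / 4) * (Real.exp (-(π * d / h)) * h)) := by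
  have hmax := three_mul_mul_exp_neg_le_one (mul_nonneg hd.le hn.le)
  have hexponent := Real.exp_le_exp.mpr (neg_mul_sinh_le hd hn hh hmesh hγ hX hγX hμδ)
  rw [Real.exp_add, Real.exp_add] at hexponent
  refine le_of_mul_le_mul_left ?_ (mul_pos hd hn)
  calc d * n * (3 * Real.exp (-(γ * (π / 2) * Real.sinh X)))
      ≤ d * n * (3 * (Real.exp (-(π * (d * n) * Real.exp (-1))) *
          (Real.exp (π * (γ + δ) / 4) * Real.exp (-(π * d / h))))) := by gcongr
    _ = 3 * (d * n) * Real.exp (-(π * (d * n) * Real.exp (-1))) *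
          (Real.exp (π * (γ + δ) / 4) * Real.exp (-(π * d / h))) := by ring
    _ ≤ n * h * (Real.exp (π * (γ + δ) / 4) * Real.exp (-(π * d / h))) :=
        mul_le_mul_of_nonneg_right (hmax.trans hh) (by positivity)
    _ = d * n * (1 / d * (Real.exp (π * (γ + δ) / 4) * (Real.exp (-(π * d / h)) * h))) := by
        field_simp

theorem tail_bound_le {K X ν : ℝ} (hK : 0 ≤ K) (hμ : 0 < μ) (hμγ : μ ≤ γ) (hγν : γ ≤ ν)
    (hd : 0 < d) (hn : 0 < n) (hh : 1 ≤ n * h) (hmesh : 4 * d * n = μ * Real.exp (n * h))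
    (hX : 0 ≤ X) (hγX : 4 * d * n ≤ γ * Real.exp X) (hμδ : μ ≤ δ) :
    3 * K * (2 ^ γ / γ) * Real.exp (-(γ * (π / 2) * Real.sinh X)) ≤
      2 ^ ν * K / (μ * d) * (Real.exp (π * (γ + δ) / 4) * (Real.exp (-(π * d / h)) * h)) := by
  have hγ : 0 < γ := hμ.trans_le hμγ
  have hexp := three_mul_exp_neg_mul_sinh_le hd hn hh hmesh hγ.le hX hγX hμδ
  have hrpow : (2 : ℝ) ^ γ / γ ≤ 2 ^ ν / μ :=
    div_le_div₀ (by positivity) (Real.rpow_le_rpow_of_exponent_le one_le_two hγν) hμ hμγ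
  calc 3 * K * (2 ^ γ / γ) * Real.exp (-(γ * (π / 2) * Real.sinh X))
      = K * (2 ^ γ / γ) * (3 * Real.exp (-(γ * (π / 2) * Real.sinh X))) := by ring
    _ ≤ K * (2 ^ ν / μ) *
          (1 / d * (Real.exp (π * (γ + δ) / 4) * (Real.exp (-(π * d / h)) * h))) := by gcongr
    _ = _ := by field_simp

theorem mul_exp_le_mul_exp_sub_floor {a b : ℝ} (ha : 0 < a) (hb : 0 < b) (hh : 0 < h) (n : ℕ) :
    a * Real.exp (n * h) ≤
      b * Real.exp ((((n : ℤ) - ⌊Real.log (b / a) / h⌋ : ℤ) : ℝ) * h) := by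
  have hfloor : (⌊Real.log (b / a) / h⌋ : ℝ) * h ≤ Real.log (b / a) :=
    (le_div_iff₀ hh).mp (Int.floor_le _)
  calc a * Real.exp (n * h) = b * Real.exp (n * h - Real.log (b / a)) := by
        rw [Real.exp_sub, Real.exp_log (by positivity)]
        field_simp
    _ ≤ _ := by
        push_cast
        gcongr
        linarith

theorem min_mul_exp_le_mul_exp_indexM {α β : ℝ} (hα : 0 < α) (hβ : 0 < β) (hh : 0 < h) (n : ℕ) :
    min α β * Real.exp (n * h) ≤ α * Real.exp (indexM α β h n * h) := by
  unfold indexM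
  split_ifs with hmin
  · rw [hmin, Int.cast_natCast]
  · rw [(min_choice α β).resolve_left hmin]
    exact mul_exp_le_mul_exp_sub_floor hβ hα hh n

theorem min_mul_exp_le_mul_exp_indexN {α β : ℝ} (hα : 0 < α) (hβ : 0 < β) (hh : 0 < h) (n : ℕ) :
    min α β * Real.exp (n * h) ≤ β * Real.exp (indexN α β h n * h) := by
  unfold indexN
  split_ifs with hmin
  · rw [hmin]
    exact mul_exp_le_mul_exp_sub_floor hα hβ hh n
  · rw [(min_choice α β).resolve_left hmin, Int.cast_natCast]

theorem one_le_log_mesh (hd : 0 < d) (hμ : 0 < μ) (hn : μ * Real.exp 1 / (4 * d) ≤ n) :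
    1 ≤ Real.log (4 * d * n / μ) := by
  rw [div_le_iff₀' (by positivity)] at hn
  rw [Real.le_log_iff_exp_le (div_pos ((by positivity : 0 < μ * Real.exp 1).trans_le hn) hμ)]
  rwa [le_div_iff₀' hμ]

theorem rate_eq (d μ : ℝ) (n : ℕ) :
    rate d μ n = Real.exp (-(π * d / (Real.log (4 * d * n / μ) / n))) *
      (Real.log (4 * d * n / μ) / n) := by
  rw [rate, div_div_eq_mul_div, mul_div_assoc]

theorem DecayClass.norm_integral_Iic_sub_sum_le {f : ℂ → ℂ} {K α β : ℝ}
    (hf : DecayClass f d K α β) (hK : 0 ≤ K) (hα : 0 < α) (hβ : 0 < β) (hd0 : 0 < d)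
    (hd : d < π / 2) (hn : 0 < n) (hh : 1 ≤ n * h)
    (hmesh : 4 * d * n = min α β * Real.exp (n * h)) {M N : ℤ}
    (hM : xThreshold (α / 2) ≤ M * h) (hN : xThreshold (β / 2) ≤ N * h)
    (hMexp : 4 * d * n ≤ α * Real.exp (M * h)) (hNexp : 4 * d * n ≤ β * Real.exp (N * h)) (ξ : ℝ) :
    ‖(∫ x in Iic ξ, deIntegrand f (x : ℂ)) -
        ∑ k ∈ Finset.Icc (-M) N, deIntegrand f ((k * h : ℝ) : ℂ) * (J k h ξ : ℂ)‖ ≤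
      C1 K d α β * (Real.exp (-(π * d / h)) * h) := by
  have hμ : 0 < min α β := lt_min hα hβ
  have hh0 : 0 < h := pos_of_mul_pos_right (zero_lt_one.trans_le hh) hn.le
  have hM0 : 0 ≤ M * h := (xThreshold_pos (half_pos hα)).le.trans hM
  have hN0 : 0 ≤ N * h := (xThreshold_pos (half_pos hβ)).le.trans hN
  have hcos : 0 < Real.cos d := Real.cos_pos_of_mem_Ioo ⟨by linarith, hd⟩
  have hq := cos_half_pi_mul_sin_pos hd0.le hd
  refine (norm_sub_le_norm_sub_add_norm_sub _
    (∑' k : ℤ, deIntegrand f ((k * h : ℝ) : ℂ) * (J k h ξ : ℂ)) _).trans ?_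
  refine (add_le_add
    ((hf.norm_integral_Iic_sub_tsum_le hK hα hβ hd0 hd hh0 ξ).trans
      (mul_le_mul_of_nonneg_left (div_pi_mul_sinh_le hn hh0 hμ hmesh) (by positivity)))
    ((hf.norm_tsum_sub_sum_le hK hα hβ hd0 hd hh0 hM hN ξ).trans (add_le_add
      (tail_bound_le hK hμ (min_le_left α β) (le_max_left α β) hd0 hn hh hmesh hM0 hMexp
        (min_le_right α β))
      (tail_bound_le hK hμ (min_le_right α β) (le_max_right α β) hd0 hn hh hmesh hN0 hNexp
        (min_le_left α β))))).trans_eq ?_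
  rw [C1, Real.rpow_add two_pos, Real.rpow_one, add_comm β α]
  generalize 1 - Real.exp (-(π * min α β * Real.exp 1 / 2)) = E
  ring

end Parameters

end SincDE

theorem theorem3p4
    (d : ℝ) (hd0 : 0 < d) (hd : d < Real.pi / 2)
    (f : ℂ → ℂ) (hf : AnalyticOnNhd ℂ f (SincDE.psi '' SincDE.strip d))
    (K α β : ℝ) (hK : 0 < K) (hα : 0 < α) (hβ : 0 < β)
    (hneg : ∀ z ∈ SincDE.psi '' SincDE.stripNeg d, ‖f z‖ ≤ K * ‖SincDE.E1 z α‖)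
    (hpos : ∀ z ∈ SincDE.psi '' SincDE.stripPos d, ‖f z‖ ≤ K * ‖SincDE.E1 z β‖)
    (μ ν : ℝ) (hμ : μ = min α β) (hν : ν = max α β)
    (n : ℕ) (h : ℝ) (hh : h = Real.log (4 * d * n / μ) / n)
    (M N : ℤ) (hM : M = SincDE.indexM α β h n) (hN : N = SincDE.indexN α β h n)
    (hn : ν * Real.exp 1 / (4 * d) ≤ n)
    (hMh : SincDE.xThreshold (α / 2) ≤ M * h)
    (hNh : SincDE.xThreshold (β / 2) ≤ N * h) :
    MeasureTheory.Integrable (fun t : ℝ => f (t : ℂ)) ∧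
      ∀ τ : ℝ,
        ‖(∫ t in Set.Iic τ, f (t : ℂ)) -
            ∑ k ∈ Finset.Icc (-M) N,
              f (SincDE.psi ((k * h : ℝ) : ℂ)) * deriv SincDE.psi ((k * h : ℝ) : ℂ) *
                (SincDE.J k h (SincDE.psiInv τ) : ℂ)‖ ≤
          SincDE.C1 K d α β * SincDE.rate d μ n := by
  have hf : SincDE.DecayClass f d K α β := ⟨hf, hneg, hpos⟩
  refine ⟨(SincDE.integrable_iff_integrable_deIntegrand f).mpr
    (hf.integrable_deIntegrand_ofReal hK.le hα hβ hd0 hd), fun τ => ?_⟩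
  subst hμ hν hM hN
  have hμ : 0 < min α β := lt_min hα hβ
  have hμn := (div_le_div_of_nonneg_right (mul_le_mul_of_nonneg_right min_le_max
    (Real.exp_pos 1).le) (by positivity)).trans hn
  have hn0 : (0 : ℝ) < n := lt_of_lt_of_le (by positivity) hμn
  have hlog : n * h = Real.log (4 * d * n / min α β) := by rw [hh, mul_div_cancel₀ _ hn0.ne']
  have hnh : 1 ≤ n * h := hlog ▸ SincDE.one_le_log_mesh hd0 hμ hμn
  have hh0 : 0 < h := pos_of_mul_pos_right (zero_lt_one.trans_le hnh) hn0.le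
  have hmesh : 4 * d * n = min α β * Real.exp (n * h) := by
    rw [hlog, Real.exp_log (by positivity), mul_div_cancel₀ _ hμ.ne']
  rw [SincDE.integral_Iic_eq_integral_Iic_deIntegrand, SincDE.rate_eq, ← hh]
  exact hf.norm_integral_Iic_sub_sum_le hK.le hα hβ hd0 hd hn0 hnh hmesh hMh hNh
    (hmesh.trans_le (SincDE.min_mul_exp_le_mul_exp_indexM hα hβ hh0 n))
    (hmesh.trans_le (SincDE.min_mul_exp_le_mul_exp_indexN hα hβ hh0 n)) _
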